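/- Let $S^1=\mathbb R/\mathbb Z$ and let $\gamma\colon S^1\to\mathbb R^2$ be a closed curve, not necessarily simple, that is $C^3$ and regular. In a configuration $(x,y)\in S^1\times S^1$ the human is at $\gamma(x)$ and the puppy at $\gamma(y)$; put $E(x,y)=|\gamma(x)-\gamma(y)|^2$. A configuration is *forward* if $\partial_yE<0$, *backward* if $\partial_yE>0$, and *critical* if $\partial_yE=0$. A critical configuration is *stable* if $\partial_y^2E>0$, *unstable* if $\partial_y^2E<0$, a *forward pivot configuration* if $\partial_y^2E=0$ and $\partial_y^3E<0$, and a *backward pivot configuration* if $\partial_y^2E=0$ and $\partial_y^3E>0$. The track $\gamma$ is *generic* if every critical configuration is of one of these four kinds, and $\gamma'(x)\cdot\gamma'(y)\neq0$ for every pivot configuration $(x,y)$ (equivalently, $\gamma$ meets its evolute transversely and away from the cusps of the evolute). The critical configurations of a generic track form finitely many disjoint simple closed curves on the torus $S^1\times S^1$, the connected components of the critical set, which are called *critical cycles*; the main diagonal $x=y$ is one of them. A critical cycle is *contractible* if it is the boundary of a simply connected closed subset of the torus, and *essential* otherwise. While the human stands still, the puppy *runs forward* (resp. *backward*) from $(x,y)$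 by increasing (resp. decreasing) $y$ through forward configurations and forward pivot configurations (resp. backward configurations and backward pivot configurations) until it reaches a stable configuration; from an unstable configuration it may run in either direction. In a *walk* the human and the puppy move continuously through stable configurations, ending in a stable configuration or on reaching a pivot configuration. A *strategy* is a finite sequence of walks and runs that ends on the main diagonal. A configuration is *dexter* (resp. *sinister*) if it is the start of a strategy whose last step is a backward (resp. forward) run onto the main diagonal; configurations on the main diagonal, where the run is trivial, count as both. **Theorem.** Let $\gamma$ be a generic track that has exactly two essential critical cycles. Then every configuration is dexter or sinister. Consequently, from every starting configuration the human can catch the puppy, i.e. force the configuration onto the main diagonal after finitely many walks and runs, whichever way the puppy runs when it has a choice. -/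

import Mathlib

namespace Puppy

/-- The Euclidean plane. -/
abbrev Plane : Type := EuclideanSpace ℝ (Fin 2)

/-- The configuration torus `S¹ × S¹`, with `S¹ = ℝ / ℤ`. In `(x, y)` the human stands at
`γ x` and the puppy at `γ y`. -/
abbrev Config : Type := UnitAddCircle × UnitAddCircle

/-- The velocity `γ'(x)`. -/
noncomputable def velocity (γ : UnitAddCircle → Plane) (x : UnitAddCircle) : Plane :=
  deriv (fun t : ℝ => γ (x + (t : UnitAddCircle))) 0

/-- The `k`-th partial derivative, in the puppy's position `y`, of the squared distance
`D(x, y)²`. Where `D(x, y) ≠ 0`, the sign of the first nonzero derivative of order at most three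
is the same for `D` and `D²`; unlike `D`, the function `D²` is also differentiable where
`γ x = γ y`, and in particular on the main diagonal, which it makes stable. -/
noncomputable def partialY (γ : UnitAddCircle → Plane) (k : ℕ) (p : Config) : ℝ :=
  iteratedDeriv k (fun t : ℝ => dist (γ p.1) (γ (p.2 + (t : UnitAddCircle))) ^ 2) 0

def IsForward (γ : UnitAddCircle → Plane) (p : Config) : Prop := partialY γ 1 p < 0

def IsBackward (γ : UnitAddCircle → Plane) (p : Config) : Prop := 0 < partialY γ 1 p

def IsCritical (γ : UnitAddCircle → Plane) (p : Config) : Prop := partialY γ 1 p = 0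

def IsStable (γ : UnitAddCircle → Plane) (p : Config) : Prop :=
  IsCritical γ p ∧ 0 < partialY γ 2 p

def IsUnstable (γ : UnitAddCircle → Plane) (p : Config) : Prop :=
  IsCritical γ p ∧ partialY γ 2 p < 0

def IsForwardPivot (γ : UnitAddCircle → Plane) (p : Config) : Prop :=
  IsCritical γ p ∧ partialY γ 2 p = 0 ∧ partialY γ 3 p < 0

def IsBackwardPivot (γ : UnitAddCircle → Plane) (p : Config) : Prop :=
  IsCritical γ p ∧ partialY γ 2 p = 0 ∧ 0 < partialY γ 3 p

def IsPivot (γ : UnitAddCircle → Plane) (p : Config) : Prop :=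
  IsForwardPivot γ p ∨ IsBackwardPivot γ p

/-- A generic track: a closed regular `C³` curve, not necessarily simple, that meets its evolute
only away from the cusps of the evolute (`exhaustive`) and only transversely (`transverse`: at a
pivot configuration `(x, y)` the point `γ x` is the center of curvature at `γ y`, where the
evolute is tangent to the normal line of `γ` at `γ y`). -/
structure IsGenericTrack (γ : UnitAddCircle → Plane) : Prop where
  contDiff : ContDiff ℝ 3 (fun t : ℝ => γ (t : UnitAddCircle))
  regular : ∀ x, velocity γ x ≠ 0
  exhaustive : ∀ p : Config, IsCritical γ p → IsStable γ p ∨ IsUnstable γ p ∨ IsPivot γ p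
  transverse : ∀ p : Config, IsPivot γ p → inner ℝ (velocity γ p.1) (velocity γ p.2) ≠ 0

/-- The critical cycles of the attraction diagram. For a generic track the critical
configurations form a disjoint union of finitely many simple closed curves, so that these
curves are the connected components of the critical set. -/
def IsCriticalCycle (γ : UnitAddCircle → Plane) (C : Set Config) : Prop :=
  ∃ p, IsCritical γ p ∧ C = connectedComponentIn {q | IsCritical γ q} p

/-- `C` is the boundary of a simply connected closed subset of the torus. (Without `IsClosed`,
every simple closed curve would qualify: it is the boundary of the arc that is left when one of
its points is removed.) -/
def IsContractible (C : Set Config) : Prop :=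
  ∃ U : Set Config, IsClosed U ∧ SimplyConnectedSpace U ∧ frontier U = C

/-- The essential critical cycles of the attraction diagram. -/
def essentialCycles (γ : UnitAddCircle → Plane) : Set (Set Config) :=
  {C | IsCriticalCycle γ C ∧ ¬ IsContractible C}

/-- The human walks, and the puppy follows, along stable configurations from `p` to `q`; the
walk ends in a stable configuration or on reaching a pivot configuration. -/
def Walk (γ : UnitAddCircle → Plane) (p q : Config) : Prop :=
  (∃ f : Path p q, ∀ t : unitInterval, t < 1 → IsStable γ (f t)) ∧ (IsStable γ q ∨ IsPivot γ q)

/-- The puppy runs forward from `p` until it reaches the stable configuration `q`, while the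
human stands still: an upward vertical segment. -/
def ForwardRun (γ : UnitAddCircle → Plane) (p q : Config) : Prop :=
  ∃ s : ℝ, 0 < s ∧ q = (p.1, p.2 + (s : UnitAddCircle)) ∧ IsStable γ q ∧
    ∀ t ∈ Set.Ioo 0 s, IsForward γ (p.1, p.2 + (t : UnitAddCircle)) ∨
      IsForwardPivot γ (p.1, p.2 + (t : UnitAddCircle))

/-- The puppy runs backward from `p` until it reaches the stable configuration `q`, while the
human stands still: a downward vertical segment. -/
def BackwardRun (γ : UnitAddCircle → Plane) (p q : Config) : Prop :=
  ∃ s : ℝ, 0 < s ∧ q = (p.1, p.2 - (s : UnitAddCircle)) ∧ IsStable γ q ∧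
    ∀ t ∈ Set.Ioo 0 s, IsBackward γ (p.1, p.2 - (t : UnitAddCircle)) ∨
      IsBackwardPivot γ (p.1, p.2 - (t : UnitAddCircle))

/-- From an unstable configuration the puppy can run either way; from a forward or backward
configuration or a pivot configuration, only one of the two runs is possible, and from a stable
configuration none. -/
def Run (γ : UnitAddCircle → Plane) (p q : Config) : Prop :=
  ForwardRun γ p q ∨ BackwardRun γ p q

def Move (γ : UnitAddCircle → Plane) (p q : Config) : Prop := Walk γ p q ∨ Run γ p q

/-- `p` starts a strategy that ends with a backward run onto the main diagonal. On the main
diagonal itself the puppy is already caught and the final run is trivial. (The main diagonal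
cannot be left, nor can it be entered by a walk.) -/
def IsDexter (γ : UnitAddCircle → Plane) (p : Config) : Prop :=
  p.1 = p.2 ∨ ∃ q r : Config, Relation.ReflTransGen (Move γ) p q ∧ BackwardRun γ q r ∧ r.1 = r.2

/-- `p` starts a strategy that ends with a forward run onto the main diagonal. -/
def IsSinister (γ : UnitAddCircle → Plane) (p : Config) : Prop :=
  p.1 = p.2 ∨ ∃ q r : Config, Relation.ReflTransGen (Move γ) p q ∧ ForwardRun γ q r ∧ r.1 = r.2

/-- The human can force the puppy to be caught after finitely many moves: the human chooses the
walks, and whenever the puppy runs, every possible outcome of the run has to be good for the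
human. -/
inductive CanCatch (γ : UnitAddCircle → Plane) : Config → Prop
  | caught (x : UnitAddCircle) : CanCatch γ (x, x)
  | walk (p q : Config) : Walk γ p q → CanCatch γ q → CanCatch γ p
  | run (p : Config) : (∃ q, Run γ p q) → (∀ q, Run γ p q → CanCatch γ q) → CanCatch γ p

end Puppy

namespace Puppy

open Set Filter Topology unitInterval

/-! ### Topology of the torus and the strip -/

/-! Suppose that the puppy can escape from some stable configuration. Cut the torus along the main
diagonal, pass to the strip `x < y < x + 1` in the plane, and let `R` consist of the lifts of the
stable configurations with an escape. The human chooses the walks, so near a point of `R` all stable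
points are in `R`; where a stable arc of `R` ends at a pivot, some run from the pivot escapes, and
it lands in `R` again, on the same vertical line and without reaching the diagonal. Thus `R` is a
trap (`isTrap_escape`). It continues past every fold of the critical set, hence meets every vertical
line (`IsTrap.exists_mem`).

Let `g` be the lift of `∂E/∂y`, let `A` be the part of `{0 ≤ g}` above `R` and `B` the part of `{g ≤
0}` below `R`. The runs from pivots back into `R` keep these parts from leaking around the ends of
arcs: `A` is clopen in `{0 ≤ g}` (`IsTrap.eventually_mem_upperPart`), and by symmetry `B` is clopen
in `{g ≤ 0}`. Every zero of `g` lies in `A` or in `B`. So the zeros inside the strip fall into three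
disjoint closed pieces (only in `B`, in both, only in `A`), and each piece separates the two
boundary lines of the strip.

A separating piece meets an essential component of the critical set (`exists_essential`). Otherwise
the angle `x` has a real-valued lift on the piece, and a map from the strip to the circle can be
built whose winding number is `-1` along the bottom line and `0` along the top line
(`strip_separation`). This gives three essential cycles, even without the diagonal
(`IsTrap.exists_three`), where only two are allowed.

Hence all stable configurations can be caught, and every other configuration runs to a stable one
(`Lifts.exists_run`). Since the diagonal cannot be entered by a walk, a game won from outside it
ends with a run onto it, and the direction of that run decides between dexter and sinister. -/

theorem eq_of_int_valued {X : Type*} [TopologicalSpace X] [PreconnectedSpace X] {f : X → ℝ}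
    (hf : Continuous f) (h : ∀ x, ∃ n : ℤ, f x = n) (a b : X) : f a = f b := by
  have hd : DiscreteTopology (range ((↑) : ℤ → ℝ)) :=
    Int.isClosedEmbedding_coe_real.isEmbedding.toHomeomorph.symm.isEmbedding.discreteTopology
  refine IsPreconnected.constant_of_mapsTo (S := univ) (T := range ((↑) : ℤ → ℝ))
    isPreconnected_univ ⟨hd⟩ hf.continuousOn (fun x _ => ?_) (mem_univ a) (mem_univ b)
  obtain ⟨n, hn⟩ := h x
  exact ⟨n, hn.symm⟩

theorem coe_eq_coe_iff_exists_int {a b : ℝ} :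
    (a : UnitAddCircle) = b ↔ ∃ n : ℤ, b - a = n := by
  rw [QuotientAddGroup.eq, AddSubgroup.mem_zmultiples_iff]
  constructor
  · rintro ⟨n, hn⟩
    exact ⟨n, by simp at hn; linarith⟩
  · rintro ⟨n, hn⟩
    exact ⟨n, by simp; linarith⟩

/-- A pair of closed sets that covers the strip `x ≤ y ≤ x + 1` and separates its two boundary
lines has an essential intersection. -/
theorem strip_separation {P Q : Set (ℝ × ℝ)} (hP : IsClosed P) (hQ : IsClosed Q)
    (hPinv : ∀ x y, (x + 1, y + 1) ∈ P ↔ (x, y) ∈ P)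
    {ψ : ℝ × ℝ → ℝ} (hψ : Continuous ψ) (hψ1 : ∀ x y, ψ (x + 1, y + 1) = ψ (x, y) - 1)
    (hcov : ∀ x y, x ≤ y → y ≤ x + 1 → (x, y) ∈ P ∨ (x, y) ∈ Q)
    (hint : ∀ x y, x ≤ y → y ≤ x + 1 → (x, y) ∈ P → (x, y) ∈ Q → ∃ n : ℤ, ψ (x, y) = n)
    (hbot : ∀ x, (x, x) ∈ P) (htop : ∀ x, (x, x + 1) ∈ Q) : False := by
  classical
  -- The retraction onto the closed strip along vertical lines makes `F` below a map on the whole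
  -- plane, where lifts through `ℝ → ℝ / ℤ` exist.
  let ρ : ℝ × ℝ → ℝ × ℝ := fun z => (z.1, max z.1 (min z.2 (z.1 + 1)))
  have hρ : Continuous ρ := by fun_prop
  have hρ1 : ∀ z, (ρ z).1 ≤ (ρ z).2 := fun z => le_max_left _ _
  have hρ2 : ∀ z, (ρ z).2 ≤ (ρ z).1 + 1 := fun z =>
    max_le (by simp [ρ]) (min_le_right _ _)
  have hρ3 : ∀ x y, ρ (x + 1, y + 1) = ((ρ (x, y)).1 + 1, (ρ (x, y)).2 + 1) := fun x y => by
    simp [ρ, max_add_add_right, min_add_add_right]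
  -- The two formulas agree where `P` meets `Q`, because `ψ` is an integer there. `F` winds `-1`
  -- times along one period of the bottom line and is constant on the top line.
  let F : ℝ × ℝ → UnitAddCircle := fun z => if z ∈ ρ ⁻¹' P then (ψ (ρ z) : UnitAddCircle) else 0
  have hzero : ∀ z, ρ z ∈ P → ρ z ∈ Q → (ψ (ρ z) : UnitAddCircle) = 0 := fun z h1 h2 => by
    obtain ⟨n, hn⟩ := hint _ _ (hρ1 z) (hρ2 z) h1 h2
    change ψ (ρ z) = n at hn
    rw [hn, eq_comm, ← AddCircle.coe_zero, coe_eq_coe_iff_exists_int]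
    exact ⟨n, by simp⟩
  have hF : Continuous F := by
    refine Continuous.if (fun z hz => ?_) ?_ continuous_const
    · have hz1 : z ∈ ρ ⁻¹' P := (hP.preimage hρ).frontier_subset hz
      have hz2 : z ∈ ρ ⁻¹' Q := by
        have : z ∈ closure (ρ ⁻¹' P)ᶜ := (frontier_eq_closure_inter_closure (s := ρ ⁻¹' P) ▸ hz).2
        refine closure_minimal ?_ (hQ.preimage hρ) this
        intro w hw
        exact (hcov _ _ (hρ1 w) (hρ2 w)).resolve_left hw
      exact hzero z hz1 hz2
    · exact (AddCircle.continuous_mk' 1).comp (hψ.comp hρ)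
  obtain ⟨e, he⟩ : ∃ e : ℝ, (e : UnitAddCircle) = F (0, 0) := QuotientAddGroup.mk_surjective _
  obtain ⟨Φ, ⟨-, hΦ⟩, -⟩ := (AddCircle.isCoveringMap_coe (1 : ℝ)).existsUnique_continuousMap_lifts
    ⟨F, hF⟩ (0, 0) e he
  have hΦ' : ∀ z, (Φ z : UnitAddCircle) = F z := fun z => congrFun hΦ z
  have hFinv : ∀ x y, F (x + 1, y + 1) = F (x, y) := fun x y => by
    simp only [F, mem_preimage, hρ3, hPinv, hψ1]
    congr 1
    rw [coe_eq_coe_iff_exists_int]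
    exact ⟨1, by simp⟩
  -- The increment of the lift over one period is the winding number; it cannot depend on the height
  -- in the strip.
  have hconst : ∀ a b : ℝ × ℝ, Φ (a.1 + 1, a.2 + 1) - Φ a = Φ (b.1 + 1, b.2 + 1) - Φ b := by
    refine eq_of_int_valued (f := fun a : ℝ × ℝ => Φ (a.1 + 1, a.2 + 1) - Φ a) (by fun_prop) ?_
    intro z
    have := (hΦ' z).trans ((hFinv z.1 z.2).symm.trans (hΦ' _).symm)
    exact coe_eq_coe_iff_exists_int.1 this
  have hb : ∀ a b : ℝ, Φ (a, a) - ψ (a, a) = Φ (b, b) - ψ (b, b) := by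
    refine eq_of_int_valued (f := fun a : ℝ => Φ (a, a) - ψ (a, a)) (by fun_prop) ?_
    intro a
    rw [← coe_eq_coe_iff_exists_int, hΦ']
    have : ρ (a, a) = (a, a) := by simp [ρ]
    simp [F, this, hbot]
  have ht : ∀ a b : ℝ, Φ (a, a + 1) = Φ (b, b + 1) := by
    refine eq_of_int_valued (f := fun a : ℝ => Φ (a, a + 1)) (by fun_prop) ?_
    intro a
    have h0 : ((0 : ℝ) : UnitAddCircle) = (Φ (a, a + 1) : UnitAddCircle) := by
      rw [hΦ', AddCircle.coe_zero]
      have hr : ρ (a, a + 1) = (a, a + 1) := by simp [ρ]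
      by_cases h : (a, a + 1) ∈ P
      · have := hzero (a, a + 1) (by rwa [hr]) (by rw [hr]; exact htop a)
        rw [hr] at this
        simp [F, hr, h, this]
      · simp [F, hr, h]
    simpa using coe_eq_coe_iff_exists_int.1 h0
  have h1 := hconst (0, 0) (0, 1)
  have h2 := hb 1 0
  have h3 := ht 1 0
  have h4 := hψ1 0 0
  norm_num at h1 h2 h3 h4
  linarith

/-- On a simply connected subset of the torus the first angular coordinate has a primitive
along paths. -/
theorem exists_angle {U : Set Config} (hU : SimplyConnectedSpace U) :
    ∃ φ : Config → ℝ, (∀ p ∈ U, (φ p : UnitAddCircle) = p.1) ∧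
      ∀ (p q : Config) (w : Path p q), (∀ t, w t ∈ U) → ∀ l : C(I, ℝ),
        (∀ t, (l t : UnitAddCircle) = (w t).1) → φ q - φ p = l 1 - l 0 := by
  classical
  have cov := AddCircle.isCoveringMap_coe (1 : ℝ)
  obtain ⟨b⟩ : Nonempty U := inferInstance
  obtain ⟨e, he⟩ : ∃ e : ℝ, (e : UnitAddCircle) = b.1.1 := QuotientAddGroup.mk_surjective _
  have hc : Continuous fun u : U => u.1.1 := by fun_prop
  let L : ∀ {u : U}, Path b u → C(I, ℝ) := fun w =>
    cov.liftPath (w.map hc) e (by simp [he])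
  have hL0 : ∀ {u : U} (w : Path b u), L w 0 = e := fun w => cov.liftPath_zero _ _ _
  have hLl : ∀ {u : U} (w : Path b u) t, (L w t : UnitAddCircle) = (w t).1.1 := fun w t =>
    congrFun (cov.liftPath_lifts (w.map hc : C(I, UnitAddCircle)) e (by simp [he])) t
  have hLh : ∀ {u : U} (w w' : Path b u), L w 1 = L w' 1 := fun w w' => by
    refine cov.liftPath_apply_one_eq_of_homotopicRel ?_ e _ _
    exact (SimplyConnectedSpace.paths_homotopic w w').map ⟨_, hc⟩
  -- `hLh` makes the endpoint of the lift independent of the path. Continuity of `φ` cannot be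
  -- expected, as `U` need not be locally path connected; only increments along paths are
  -- controlled.
  let φ : Config → ℝ := fun p =>
    if h : p ∈ U then L (PathConnectedSpace.somePath b ⟨p, h⟩) 1 else 0
  have hφ : ∀ (u : U) (w : Path b u), φ u.1 = L w 1 := fun u w => by
    simp only [φ, u.2, dif_pos]
    exact hLh _ _
  refine ⟨φ, fun p hp => ?_, fun p q w hw l hl => ?_⟩
  · rw [hφ ⟨p, hp⟩ (PathConnectedSpace.somePath b ⟨p, hp⟩), hLl]
    simp
  · have hp : p ∈ U := by simpa using hw 0
    have hq : q ∈ U := by simpa using hw 1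
    let w' : Path (⟨p, hp⟩ : U) ⟨q, hq⟩ :=
      { toFun := fun t => ⟨w t, hw t⟩
        continuous_toFun := by fun_prop
        source' := by simp
        target' := by simp }
    let v := PathConnectedSpace.somePath b (⟨p, hp⟩ : U)
    have hl0 : (l 0 : UnitAddCircle) = (L v 1 : UnitAddCircle) := by
      rw [hl, hLl]; simp
    obtain ⟨n, hn⟩ := coe_eq_coe_iff_exists_int.1 hl0
    -- The lift of `v.trans w'` is the lift of `v` followed by `l`, shifted by the integer `n` so as
    -- to start where the former ends.
    let v1 : Path e (L v 1) := ⟨L v, hL0 v, rfl⟩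
    let v2 : Path (L v 1) (l 1 + n) :=
      { toFun := fun t => l t + n
        continuous_toFun := by fun_prop
        source' := by linarith
        target' := rfl }
    have hT : ((v1.trans v2 : Path e (l 1 + n)) : C(I, ℝ)) = L (v.trans w') := by
      refine (cov.eq_liftPath_iff' _).2 ⟨?_, by simp⟩
      funext t
      have h2 : ∀ t, ((v2 t : ℝ) : UnitAddCircle) = (w' t).1.1 := fun t => by
        have : ((l t + n : ℝ) : UnitAddCircle) = (l t : UnitAddCircle) := by
          rw [coe_eq_coe_iff_exists_int]
          exact ⟨-n, by simp⟩
        exact this.trans (hl t)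
      have h1 : ∀ t, ((v1 t : ℝ) : UnitAddCircle) = (v t).1.1 := fun t => hLl v t
      simp only [Function.comp_apply, ContinuousMap.coe_coe, Path.map_coe, Path.trans_apply]
      split_ifs
      · exact h1 _
      · exact h2 _
    rw [hφ ⟨q, hq⟩ (v.trans w'), hφ ⟨p, hp⟩ v, ← hT]
    simp
    linarith

/-- The first angular coordinate lifts to a real function on a closed union of contractible
components of a locally path connected set. -/
theorem exists_lift_of_contractible {K Z : Set Config} (hK : IsClosed K) (hKZ : K ⊆ Z)
    (hloc : ∀ p ∈ Z, ∀ ε > 0, ∀ᶠ q in 𝓝 p, q ∈ Z → ∃ w : Path p q, (∀ t, w t ∈ Z) ∧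
      ∃ l : C(I, ℝ), (∀ t, (l t : UnitAddCircle) = (w t).1) ∧ |l 1 - l 0| < ε)
    (hcon : ∀ p ∈ K, IsContractible (connectedComponentIn Z p)) :
    ∃ φ : C(Config, ℝ), ∀ p ∈ K, (φ p : UnitAddCircle) = p.1 := by
  classical
  -- One function is fixed per component, not per point, so that nearby points of a component are
  -- compared by the same function. The value `0` for non-contractible sets is a dummy.
  have hex : ∀ C : Set Config, ∃ φ : Config → ℝ, IsContractible C →
      (∀ p ∈ C, (φ p : UnitAddCircle) = p.1) ∧
      ∀ (p q : Config) (w : Path p q), (∀ t, w t ∈ C) → ∀ l : C(I, ℝ),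
        (∀ t, (l t : UnitAddCircle) = (w t).1) → φ q - φ p = l 1 - l 0 := by
    intro C
    by_cases h : IsContractible C
    · obtain ⟨U, hUc, hU, rfl⟩ := h
      obtain ⟨φ, h1, h2⟩ := exists_angle hU
      exact ⟨φ, fun _ => ⟨fun p hp => h1 p (hUc.frontier_subset hp),
        fun p q w hw => h2 p q w fun t => hUc.frontier_subset (hw t)⟩⟩
    · exact ⟨fun _ => 0, fun h' => absurd h' h⟩
  choose Θ hΘ using hex
  let f : K → ℝ := fun p => Θ (connectedComponentIn Z p.1) p.1
  have hf : Continuous f := by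
    rw [continuous_iff_continuousAt]
    intro p
    rw [ContinuousAt, Metric.tendsto_nhds]
    intro ε hε
    have := continuous_subtype_val.continuousAt.eventually (hloc p.1 (hKZ p.2) ε hε)
    filter_upwards [this] with q hq
    obtain ⟨w, hw, l, hl, hε'⟩ := hq (hKZ q.2)
    have hw' : ∀ t, w t ∈ connectedComponentIn Z p.1 := fun t =>
      (isPreconnected_range w.continuous).subset_connectedComponentIn
        ⟨0, w.source⟩ (range_subset_iff.2 hw) ⟨t, rfl⟩
    have hq' : connectedComponentIn Z q.1 = connectedComponentIn Z p.1 :=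
      (connectedComponentIn_eq (by simpa using hw' 1)).symm
    have := (hΘ _ (hcon p.1 p.2)).2 _ _ w hw' l hl
    rw [Real.dist_eq]
    simpa [f, hq', this] using hε'
  -- Tietze extension from `K` to the torus.
  obtain ⟨φ, hφ⟩ := ContinuousMap.exists_restrict_eq hK ⟨f, hf⟩
  refine ⟨φ, fun p hp => ?_⟩
  have : φ p = f ⟨p, hp⟩ := congrArg (fun h : C(K, ℝ) => h ⟨p, hp⟩) hφ
  rw [this]
  exact (hΘ _ (hcon p hp)).1 p (mem_connectedComponentIn (hKZ hp))

end Puppy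

namespace Puppy

open Set Filter Topology unitInterval

/-! ### Local structure of the zero set of a planar function -/

theorem exists_box {f : ℝ → ℝ → ℝ} (hf : Continuous fun z : ℝ × ℝ => f z.1 z.2) {x₀ y₀ : ℝ}
    (h : 0 < f x₀ y₀) : ∃ r > 0, ∀ x y, |x - x₀| < r → |y - y₀| < r → 0 < f x y := by
  have := (hf.continuousAt (x := (x₀, y₀))).eventually (lt_mem_nhds h)
  obtain ⟨r, hr, H⟩ := Metric.eventually_nhds_iff.1 this
  refine ⟨r, hr, fun x y hx hy => @H (x, y) ?_⟩
  rw [Prod.dist_eq, Real.dist_eq, Real.dist_eq]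
  exact max_lt hx hy

theorem exists_box_neg {f : ℝ → ℝ → ℝ} (hf : Continuous fun z : ℝ × ℝ => f z.1 z.2) {x₀ y₀ : ℝ}
    (h : f x₀ y₀ < 0) : ∃ r > 0, ∀ x y, |x - x₀| < r → |y - y₀| < r → f x y < 0 := by
  obtain ⟨r, hr, H⟩ := exists_box (f := fun x y => -f x y) hf.neg (neg_pos.2 h)
  exact ⟨r, hr, fun x y hx hy => neg_pos.1 (H x y hx hy)⟩

/-- The position of a sign change from negative to positive depends continuously on the
parameter. -/
theorem continuousOn_of_crossing {f : ℝ → ℝ → ℝ} (hf : Continuous fun z : ℝ × ℝ => f z.1 z.2)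
    {J : Set ℝ} {a b : ℝ} {s : ℝ → ℝ} (hs : ∀ x ∈ J, a ≤ s x ∧ s x ≤ b)
    (hneg : ∀ x ∈ J, ∀ y, a ≤ y → y < s x → f x y < 0)
    (hpos : ∀ x ∈ J, ∀ y, s x < y → y ≤ b → 0 < f x y) : ContinuousOn s J := by
  intro x₁ hx₁
  have hcx : ∀ y, Continuous fun x => f x y := fun y =>
    hf.comp (g := fun z : ℝ × ℝ => f z.1 z.2) (f := fun x => (x, y)) (by fun_prop)
  rw [ContinuousWithinAt, tendsto_order]
  constructor
  · intro c hc
    by_cases hac : c < a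
    · filter_upwards [self_mem_nhdsWithin] with x hx using hac.trans_le (hs x hx).1
    · obtain ⟨d, hcd, hd⟩ := exists_between hc
      have h1 : f x₁ d < 0 := hneg x₁ hx₁ d (by linarith) hd
      have h2 : ∀ᶠ x in 𝓝[J] x₁, f x d < 0 :=
        ((hcx d).continuousAt.eventually (gt_mem_nhds h1)).filter_mono nhdsWithin_le_nhds
      filter_upwards [self_mem_nhdsWithin, h2] with x hx hxd
      by_contra! hle
      have := hpos x hx d (by linarith) (by linarith [(hs x₁ hx₁).2])
      linarith
  · intro c hc
    by_cases hbc : b < c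
    · filter_upwards [self_mem_nhdsWithin] with x hx using (hs x hx).2.trans_lt hbc
    · obtain ⟨d, hd, hdc⟩ := exists_between hc
      have h1 : 0 < f x₁ d := hpos x₁ hx₁ d hd (by linarith)
      have h2 : ∀ᶠ x in 𝓝[J] x₁, 0 < f x d :=
        ((hcx d).continuousAt.eventually (lt_mem_nhds h1)).filter_mono nhdsWithin_le_nhds
      filter_upwards [self_mem_nhdsWithin, h2] with x hx hxd
      by_contra! hle
      have := hneg x hx d (by linarith [(hs x₁ hx₁).1]) (by linarith)
      linarith

theorem strictMonoOn_of_hasDerivAt {f f' : ℝ → ℝ} (hf : ∀ y, HasDerivAt f (f' y) y) {a b : ℝ}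
    (h : ∀ y ∈ Ioo a b, 0 < f' y) : StrictMonoOn f (Icc a b) := by
  refine strictMonoOn_of_deriv_pos (convex_Icc a b)
    (fun y _ => (hf y).continuousAt.continuousWithinAt) fun y hy => ?_
  rw [interior_Icc] at hy
  rw [(hf y).deriv]
  exact h y hy

theorem strictAntiOn_of_hasDerivAt {f f' : ℝ → ℝ} (hf : ∀ y, HasDerivAt f (f' y) y) {a b : ℝ}
    (h : ∀ y ∈ Ioo a b, f' y < 0) : StrictAntiOn f (Icc a b) := by
  refine strictAntiOn_of_deriv_neg (convex_Icc a b)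
    (fun y _ => (hf y).continuousAt.continuousWithinAt) fun y hy => ?_
  rw [interior_Icc] at hy
  rw [(hf y).deriv]
  exact h y hy

/-- Near a zero where the derivative in `y` is positive, the zero set is a graph over `x`. -/
theorem exists_graph {f fy : ℝ → ℝ → ℝ} (hf : Continuous fun z : ℝ × ℝ => f z.1 z.2)
    (hfy : Continuous fun z : ℝ × ℝ => fy z.1 z.2) (hd : ∀ x y, HasDerivAt (f x) (fy x y) y)
    {x₀ y₀ : ℝ} (h0 : f x₀ y₀ = 0) (h1 : 0 < fy x₀ y₀) {ε : ℝ} (hε : 0 < ε) :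
    ∃ η δ : ℝ, 0 < η ∧ η < ε ∧ 0 < δ ∧ δ < ε ∧ ∃ s : ℝ → ℝ,
      ContinuousOn s (Ioo (x₀ - δ) (x₀ + δ)) ∧ ∀ x, |x - x₀| < δ →
        |s x - y₀| < η ∧ f x (s x) = 0 ∧ 0 < fy x (s x) ∧
        (∀ y, |y - y₀| ≤ η → y < s x → f x y < 0) ∧
        ∀ y, |y - y₀| ≤ η → s x < y → 0 < f x y := by
  obtain ⟨r, hr, hpos⟩ := exists_box hfy h1
  obtain ⟨η, hη, hη'⟩ := exists_between (lt_min hr hε)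
  have hηr := hη'.trans_le (min_le_left _ _)
  have hmono : ∀ x, |x - x₀| < r → StrictMonoOn (f x) (Icc (y₀ - η) (y₀ + η)) := fun x hx =>
    strictMonoOn_of_hasDerivAt (hd x) fun y hy => hpos x y hx (by
      rw [abs_lt]; constructor <;> linarith [hy.1, hy.2])
  have hm0 := hmono x₀ (by simpa using hr)
  have hlo : f x₀ (y₀ - η) < 0 := h0 ▸ hm0 ⟨by linarith, by linarith⟩
    ⟨by linarith, by linarith⟩ (by linarith)
  have hhi : 0 < f x₀ (y₀ + η) := h0 ▸ hm0 ⟨by linarith, by linarith⟩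
    ⟨by linarith, by linarith⟩ (by linarith)
  obtain ⟨r₁, hr₁, hlo'⟩ := exists_box_neg hf hlo
  obtain ⟨r₂, hr₂, hhi'⟩ := exists_box hf hhi
  obtain ⟨δ, hδ, hδ'⟩ := exists_between (lt_min (lt_min hr₁ hr₂) (lt_min hr hε))
  simp only [lt_min_iff] at hδ'
  have hex : ∀ x, ∃ y, |x - x₀| < δ → y ∈ Ioo (y₀ - η) (y₀ + η) ∧ f x y = 0 := by
    intro x
    by_cases hx : |x - x₀| < δ
    · have h1 := hlo' x (y₀ - η) (by linarith) (by simpa using hr₁)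
      have h2 := hhi' x (y₀ + η) (by linarith) (by simpa using hr₂)
      obtain ⟨y, hy, hy'⟩ := intermediate_value_Ioo (by linarith : y₀ - η ≤ y₀ + η)
        (fun y _ => (hd x y).continuousAt.continuousWithinAt) ⟨h1, h2⟩
      exact ⟨y, fun _ => ⟨hy, hy'⟩⟩
    · exact ⟨0, fun h => absurd h hx⟩
  choose s hs using hex
  have hneg : ∀ x, |x - x₀| < δ → ∀ y, |y - y₀| ≤ η → y < s x → f x y < 0 := by
    intro x hx y hy hys
    obtain ⟨hs1, hs2⟩ := hs x hx
    rw [abs_le] at hy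
    exact hs2 ▸ hmono x (by linarith) ⟨by linarith, by linarith⟩ ⟨hs1.1.le, hs1.2.le⟩ hys
  have hpos' : ∀ x, |x - x₀| < δ → ∀ y, |y - y₀| ≤ η → s x < y → 0 < f x y := by
    intro x hx y hy hys
    obtain ⟨hs1, hs2⟩ := hs x hx
    rw [abs_le] at hy
    exact hs2 ▸ hmono x (by linarith) ⟨hs1.1.le, hs1.2.le⟩ ⟨by linarith, by linarith⟩ hys
  have habs : ∀ x ∈ Ioo (x₀ - δ) (x₀ + δ), |x - x₀| < δ := fun x hx => by
    rw [abs_lt]; constructor <;> linarith [hx.1, hx.2]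
  refine ⟨η, δ, hη, hη'.trans_le (min_le_right _ _), hδ, hδ'.2.2, s, ?_, ?_⟩
  · refine continuousOn_of_crossing hf (a := y₀ - η) (b := y₀ + η)
      (fun x hx => ⟨(hs x (habs x hx)).1.1.le, (hs x (habs x hx)).1.2.le⟩) ?_ ?_
    · intro x hx y hy hys
      exact hneg x (habs x hx) y
        (by rw [abs_le]; constructor <;> linarith [(hs x (habs x hx)).1.2]) hys
    · intro x hx y hys hy
      exact hpos' x (habs x hx) y
        (by rw [abs_le]; constructor <;> linarith [(hs x (habs x hx)).1.1]) hys
  · intro x hx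
    obtain ⟨hs1, hs2⟩ := hs x hx
    have h3 : |s x - y₀| < η := by rw [abs_lt]; constructor <;> linarith [hs1.1, hs1.2]
    exact ⟨h3, hs2, hpos x _ (by linarith) (by linarith), hneg x hx, hpos' x hx⟩

/-- Normal form of a fold: the zeros near the origin lie over `t ≥ 0`, and the increasing ones
form a graph that ends at the origin. -/
theorem exists_fold {k kt ky kyy : ℝ → ℝ → ℝ} (hk : Continuous fun z : ℝ × ℝ => k z.1 z.2)
    (hkt : Continuous fun z : ℝ × ℝ => kt z.1 z.2)
    (hkyy : Continuous fun z : ℝ × ℝ => kyy z.1 z.2)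
    (hdt : ∀ t y, HasDerivAt (fun t => k t y) (kt t y) t)
    (hdy : ∀ t y, HasDerivAt (k t) (ky t y) y)
    (hdyy : ∀ t y, HasDerivAt (ky t) (kyy t y) y)
    (h0 : k 0 0 = 0) (hy0 : ky 0 0 = 0) (hyy0 : kyy 0 0 < 0) (ht0 : 0 < kt 0 0)
    {ε : ℝ} (hε : 0 < ε) :
    ∃ η δ : ℝ, 0 < η ∧ η < ε ∧ 0 < δ ∧ δ < ε ∧ ∃ s : ℝ → ℝ,
      ContinuousOn s (Ico 0 δ) ∧ s 0 = 0 ∧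
      (∀ t ∈ Ioo 0 δ, (-η < s t ∧ s t < 0) ∧ k t (s t) = 0 ∧ 0 < ky t (s t) ∧
        (∀ y ∈ Icc (-η) η, 0 ≤ k t y → s t ≤ y) ∧
        ∀ y ∈ Icc (-η) η, k t y = 0 → 0 < ky t y → y = s t) ∧
      ∀ t ∈ Ioc (-δ) 0, ∀ y ∈ Icc (-η) η, 0 ≤ k t y → t = 0 ∧ y = 0 := by
  obtain ⟨r, hr, htpos⟩ := exists_box hkt ht0
  obtain ⟨r', hr', hyyneg⟩ := exists_box_neg hkyy hyy0
  obtain ⟨η, hη, hη'⟩ := exists_between (lt_min (lt_min hr hr') hε)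
  simp only [lt_min_iff] at hη'
  obtain ⟨⟨hηr, hηr'⟩, hηε⟩ := hη'
  have hanti : ∀ t, |t| < r' → StrictAntiOn (ky t) (Icc (-η) η) := fun t ht =>
    strictAntiOn_of_hasDerivAt (hdyy t) fun y hy => hyyneg t y (by simpa using ht) (by
      rw [abs_lt]; constructor <;> linarith [hy.1, hy.2])
  have ha0 := hanti 0 (by simpa using hr')
  have hneg0 : ∀ y ∈ Icc (-η) η, y ≠ 0 → k 0 y < 0 := by
    intro y hy hne
    rcases lt_or_gt_of_ne hne with h | h
    · have := strictMonoOn_of_hasDerivAt (hdy 0) (a := -η) (b := 0) fun z hz =>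
        hy0.symm.trans_lt (ha0 ⟨hz.1.le, by linarith [hz.2]⟩ ⟨by linarith, hη.le⟩ hz.2)
      exact (this ⟨hy.1, h.le⟩ ⟨by linarith, le_rfl⟩ h).trans_eq h0
    · have := strictAntiOn_of_hasDerivAt (hdy 0) (a := 0) (b := η) fun z hz =>
        (ha0 ⟨by linarith, hη.le⟩ ⟨by linarith [hz.1], hz.2.le⟩ hz.1).trans_eq hy0
      exact (this ⟨le_rfl, hη.le⟩ ⟨h.le, hy.2⟩ h).trans_eq h0
  have hle0 : ∀ y ∈ Icc (-η) η, k 0 y ≤ 0 := fun y hy => by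
    by_cases h : y = 0
    · rw [h, h0]
    · exact (hneg0 y hy h).le
  obtain ⟨r₁, hr₁, hlo⟩ := exists_box_neg hk (hneg0 (-η) ⟨le_rfl, by linarith⟩ (by linarith))
  obtain ⟨δ, hδ, hδ'⟩ := exists_between (lt_min (lt_min hr hr') (lt_min hr₁ hε))
  simp only [lt_min_iff] at hδ'
  obtain ⟨⟨hδr, hδr'⟩, hδr₁, hδε⟩ := hδ'
  have hpos0 : ∀ t ∈ Ioo 0 δ, 0 < k t 0 := fun t ht => by
    have := strictMonoOn_of_hasDerivAt (fun t => hdt t 0) (a := 0) (b := δ) fun z hz =>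
      htpos z 0 (by rw [sub_zero, abs_lt]; constructor <;> linarith [hz.1, hz.2]) (by simpa using hr)
    exact h0.symm.trans_lt (this ⟨le_rfl, hδ.le⟩ ⟨ht.1.le, ht.2.le⟩ ht.1)
  have mvt : ∀ t {a b : ℝ}, a < b → ∃ c ∈ Ioo a b, ky t c = (k t b - k t a) / (b - a) :=
    fun t a b hab => exists_hasDerivAt_eq_slope (k t) (ky t) hab
      (fun y _ => (hdy t y).continuousAt.continuousWithinAt) fun y _ => hdy t y
  -- The clause at `t = 0` fixes the value of `s` at the fold point, where continuity is also
  -- needed.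
  have hex : ∀ t, ∃ y, (t ∈ Ioo 0 δ → y ∈ Ioo (-η) 0 ∧ k t y = 0) ∧ (t = 0 → y = 0) := by
    intro t
    by_cases ht : t ∈ Ioo 0 δ
    · have h1 := hlo t (-η) (by rw [sub_zero, abs_lt]; constructor <;> linarith [ht.1, ht.2])
        (by simpa using hr₁)
      obtain ⟨y, hy, hy'⟩ := intermediate_value_Ioo (by linarith : -η ≤ 0)
        (fun y _ => (hdy t y).continuousAt.continuousWithinAt) ⟨h1, hpos0 t ht⟩
      exact ⟨y, fun _ => ⟨hy, hy'⟩, fun h => absurd h ht.1.ne'⟩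
    · exact ⟨0, fun h => absurd h ht, fun _ => rfl⟩
  choose s hs hs0 using hex
  have hant : ∀ t ∈ Ioo 0 δ, StrictAntiOn (ky t) (Icc (-η) η) := fun t ht =>
    hanti t (by rw [abs_lt]; constructor <;> linarith [ht.1, ht.2])
  have hsy : ∀ t ∈ Ioo 0 δ, 0 < ky t (s t) := by
    intro t ht
    obtain ⟨⟨h1, h2⟩, h3⟩ := hs t ht
    obtain ⟨c, hc, hc'⟩ := mvt t h2
    have : 0 < ky t c := by
      rw [hc', h3]; exact div_pos (by linarith [hpos0 t ht]) (by linarith)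
    exact this.trans (hant t ht ⟨h1.le, by linarith⟩ ⟨by linarith [hc.1], by linarith [hc.2]⟩ hc.1)
  have hneg : ∀ t ∈ Ioo 0 δ, ∀ y, -η ≤ y → y < s t → k t y < 0 := by
    intro t ht y hy hys
    obtain ⟨⟨h1, h2⟩, h3⟩ := hs t ht
    have := strictMonoOn_of_hasDerivAt (hdy t) (a := -η) (b := s t) fun z hz =>
      (hsy t ht).trans (hant t ht ⟨hz.1.le, by linarith [hz.2]⟩ ⟨h1.le, by linarith⟩ hz.2)
    exact h3 ▸ this ⟨hy, hys.le⟩ ⟨h1.le, le_rfl⟩ hys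
  have hpos : ∀ t ∈ Ioo 0 δ, ∀ y, s t < y → y ≤ 0 → 0 < k t y := by
    intro t ht y hys hy
    obtain ⟨⟨h1, h2⟩, h3⟩ := hs t ht
    rcases hy.eq_or_lt with rfl | hy
    · exact hpos0 t ht
    -- The mean slope would be nonpositive on `(s t, y)` and positive on `(y, 0)`, against
    -- concavity.
    by_contra! hle
    obtain ⟨c, hc, hc'⟩ := mvt t hys
    obtain ⟨d, hd, hd'⟩ := mvt t hy
    have hcn : ky t c ≤ 0 := by
      rw [hc', h3]; exact div_nonpos_of_nonpos_of_nonneg (by linarith) (by linarith)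
    have hdp : 0 < ky t d := by
      rw [hd']; exact div_pos (by linarith [hpos0 t ht]) (by linarith)
    have := hant t ht (a := c) (b := d) ⟨by linarith [hc.1], by linarith [hc.2]⟩
      ⟨by linarith [hd.1], by linarith [hd.2]⟩ (hc.2.trans hd.1)
    linarith
  refine ⟨η, δ, hη, hηε, hδ, hδε, s, ?_, hs0 0 rfl, ?_, ?_⟩
  · refine continuousOn_of_crossing hk (a := -η) (b := 0) (fun t ht => ?_) ?_ ?_
    · rcases ht.1.eq_or_lt with rfl | h
      · rw [hs0 0 rfl]; constructor <;> linarith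
      · exact ⟨(hs t ⟨h, ht.2⟩).1.1.le, (hs t ⟨h, ht.2⟩).1.2.le⟩
    · intro t ht y hy hys
      rcases ht.1.eq_or_lt with rfl | h
      · rw [hs0 0 rfl] at hys
        exact hneg0 y ⟨hy, by linarith⟩ hys.ne
      · exact hneg t ⟨h, ht.2⟩ y hy hys
    · intro t ht y hys hy
      rcases ht.1.eq_or_lt with rfl | h
      · rw [hs0 0 rfl] at hys
        linarith
      · exact hpos t ⟨h, ht.2⟩ y hys hy
  · intro t ht
    obtain ⟨⟨h1, h2⟩, h3⟩ := hs t ht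
    refine ⟨⟨h1, h2⟩, h3, hsy t ht, fun y hy hk0 => ?_, fun y hy hk0 hky => ?_⟩
    · by_contra! hlt
      linarith [hneg t ht y hy.1 hlt]
    · rcases lt_trichotomy y (s t) with h | h | h
      · linarith [hneg t ht y hy.1 h]
      · exact h
      · rcases le_or_gt y 0 with hy0 | hy0
        · linarith [hpos t ht y h hy0]
        · obtain ⟨c, hc, hc'⟩ := mvt t hy0
          have hcn : ky t c < 0 := by
            rw [hc', hk0]; exact div_neg_of_neg_of_pos (by linarith [hpos0 t ht]) (by linarith)
          have := hant t ht (a := c) (b := y) ⟨by linarith [hc.1], by linarith [hc.2, hy.2]⟩ hy hc.2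
          linarith
  · intro t ht y hy hk0
    rcases ht.2.eq_or_lt with rfl | h
    · refine ⟨rfl, ?_⟩
      by_contra hne
      linarith [hneg0 y hy hne]
    · have := strictMonoOn_of_hasDerivAt (fun t => hdt t y) (a := -δ) (b := 0) fun z hz =>
        htpos z y (by rw [sub_zero, abs_lt]; constructor <;> linarith [hz.1, hz.2])
          (by rw [sub_zero, abs_lt]; constructor <;> linarith [hy.1, hy.2])
      have := this ⟨ht.1.le, h.le⟩ ⟨by linarith, le_rfl⟩ h
      simp only at this
      linarith [hle0 y hy]

/-- A continuous arc, restricted to a segment, as a path. -/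
theorem exists_path_of_continuousOn {X : Type*} [TopologicalSpace X] {c : ℝ → X} {a b : ℝ}
    (hc : ContinuousOn c (uIcc a b)) : ∃ w : Path (c a) (c b), ∀ t : I, w t = c (a + t * (b - a)) := by
  have hmem : ∀ t : I, a + t * (b - a) ∈ uIcc a b := fun t => by
    rw [mem_uIcc]
    have h0 := t.2.1
    have h1 := t.2.2
    rcases le_total a b with h | h
    · left; constructor <;> nlinarith
    · right; constructor <;> nlinarith
  exact ⟨{ toFun := fun t => c (a + t * (b - a))
           continuous_toFun := hc.comp_continuous (by fun_prop) hmem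
           source' := by simp
           target' := by simp }, fun t => rfl⟩

/-- Near a zero where the derivative in `y` does not vanish, the zero set is locally path
connected. -/
theorem exists_zero_path {f fy : ℝ → ℝ → ℝ} (hf : Continuous fun z : ℝ × ℝ => f z.1 z.2)
    (hfy : Continuous fun z : ℝ × ℝ => fy z.1 z.2) (hd : ∀ x y, HasDerivAt (f x) (fy x y) y)
    {x₀ y₀ : ℝ} (h0 : f x₀ y₀ = 0) (h1 : fy x₀ y₀ ≠ 0) {ε : ℝ} (hε : 0 < ε) :
    ∃ δ > 0, ∀ x y, |x - x₀| < δ → |y - y₀| < δ → f x y = 0 →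
      ∃ w : Path (x₀, y₀) (x, y), ∀ t, f (w t).1 (w t).2 = 0 ∧
        |(w t).1 - x₀| < ε ∧ |(w t).2 - y₀| < ε := by
  wlog hpos : 0 < fy x₀ y₀ generalizing f fy
  · have := this (f := fun x y => -f x y) (fy := fun x y => -fy x y) hf.neg hfy.neg
      (fun x y => (hd x y).neg) (by simpa using h0) (by simpa using h1)
      (by have := lt_of_le_of_ne (not_lt.1 hpos) h1; simpa using this)
    simpa using this
  obtain ⟨η, δ, hη, hηε, hδ, hδε, s, hs, H⟩ := exists_graph hf hfy hd h0 hpos hε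
  have huniq : ∀ x y, |x - x₀| < δ → |y - y₀| ≤ η → f x y = 0 → y = s x := by
    intro x y hx hy hxy
    obtain ⟨-, -, -, h3, h4⟩ := H x hx
    rcases lt_trichotomy y (s x) with h | h | h
    · linarith [h3 y hy h]
    · exact h
    · linarith [h4 y hy h]
  refine ⟨min δ η, lt_min hδ hη, fun x y hx hy hxy => ?_⟩
  rw [lt_min_iff] at hx hy
  have hy0 : s x₀ = y₀ := (huniq x₀ y₀ (by simpa) (by simpa using hη.le) h0).symm
  have hyx : s x = y := (huniq x y hx.1 hy.2.le hxy).symm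
  have hsub : uIcc x₀ x ⊆ Ioo (x₀ - δ) (x₀ + δ) := by
    rw [abs_lt] at hx
    exact OrdConnected.uIcc_subset ordConnected_Ioo ⟨by linarith, by linarith⟩
      ⟨by linarith, by linarith⟩
  obtain ⟨w, hw⟩ := exists_path_of_continuousOn (c := fun r => (r, s r)) (a := x₀) (b := x)
    (continuousOn_id.prodMk (hs.mono hsub))
  refine ⟨w.cast (by rw [hy0]) (by rw [hyx]), fun t => ?_⟩
  have hr : |x₀ + t * (x - x₀) - x₀| < δ := by
    have h0 := t.2.1
    have h1 := t.2.2
    rw [add_sub_cancel_left, abs_mul, abs_of_nonneg h0]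
    nlinarith [abs_nonneg (x - x₀), hx.1]
  obtain ⟨h1, h2, -⟩ := H _ hr
  simp only [Path.cast_coe, hw]
  exact ⟨h2, by linarith, by linarith⟩

end Puppy

namespace Puppy

open Set Filter Topology

/-! ### Attraction fields -/

/-- The lift to the plane of `∂E/∂y` for a generic track, together with its derivatives. -/
structure Attraction where
  g : ℝ → ℝ → ℝ
  gx : ℝ → ℝ → ℝ
  gy : ℝ → ℝ → ℝ
  gyy : ℝ → ℝ → ℝ
  cont : Continuous fun z : ℝ × ℝ => g z.1 z.2
  cont_x : Continuous fun z : ℝ × ℝ => gx z.1 z.2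
  cont_y : Continuous fun z : ℝ × ℝ => gy z.1 z.2
  cont_yy : Continuous fun z : ℝ × ℝ => gyy z.1 z.2
  deriv_x : ∀ x y, HasDerivAt (fun x => g x y) (gx x y) x
  deriv_y : ∀ x y, HasDerivAt (g x) (gy x y) y
  deriv_yy : ∀ x y, HasDerivAt (gy x) (gyy x y) y
  periodic_x : ∀ x y, g (x + 1) y = g x y
  periodic_y : ∀ x y, g x (y + 1) = g x y
  diag : ∀ x, g x x = 0
  diag_pos : ∀ x, 0 < gy x x
  generic : ∀ x y, g x y = 0 → gy x y = 0 → gx x y ≠ 0 ∧ gyy x y ≠ 0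

namespace Attraction

variable (D : Attraction)

def Stable (x y : ℝ) : Prop := D.g x y = 0 ∧ 0 < D.gy x y

def Pivot (x y : ℝ) : Prop := D.g x y = 0 ∧ D.gy x y = 0

/-- The attraction field of the track traversed in the opposite direction. -/
def reflect : Attraction where
  g x y := -D.g (-x) (1 - y)
  gx x y := D.gx (-x) (1 - y)
  gy x y := D.gy (-x) (1 - y)
  gyy x y := -D.gyy (-x) (1 - y)
  cont := (D.cont.comp (by fun_prop : Continuous fun z : ℝ × ℝ => (-z.1, 1 - z.2))).neg
  cont_x := D.cont_x.comp (by fun_prop : Continuous fun z : ℝ × ℝ => (-z.1, 1 - z.2))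
  cont_y := D.cont_y.comp (by fun_prop : Continuous fun z : ℝ × ℝ => (-z.1, 1 - z.2))
  cont_yy := (D.cont_yy.comp (by fun_prop : Continuous fun z : ℝ × ℝ => (-z.1, 1 - z.2))).neg
  deriv_x x y := by
    have := ((D.deriv_x (-x) (1 - y)).comp x (hasDerivAt_neg x)).neg
    convert! this using 1
    ring
  deriv_y x y := by
    have := ((D.deriv_y (-x) (1 - y)).comp y ((hasDerivAt_id y).const_sub 1)).neg
    convert! this using 1
    ring
  deriv_yy x y := by
    have := (D.deriv_yy (-x) (1 - y)).comp y ((hasDerivAt_id y).const_sub 1)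
    convert! this using 1
    ring
  periodic_x x y := by
    rw [← D.periodic_x (-(x + 1))]; congr 2; ring
  periodic_y x y := by
    rw [← D.periodic_y _ (1 - (y + 1))]; congr 2; ring
  diag x := by
    rw [show 1 - x = -x + 1 by ring, D.periodic_y, D.diag, neg_zero]
  diag_pos x := by
    have h := (D.deriv_y (-x) (-x + 1)).comp (-x) ((hasDerivAt_id (-x)).add_const 1)
    have h' : D.g (-x) ∘ (fun y => id y + 1) = D.g (-x) := funext fun y => D.periodic_y _ _
    rw [h'] at h
    have := h.unique (D.deriv_y (-x) (-x))
    rw [show 1 - x = -x + 1 by ring]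
    have h2 := D.diag_pos (-x)
    linarith
  generic x y h h' := by
    have := D.generic (-x) (1 - y) (by simpa using h) h'
    simpa using this

/-- Near the diagonal there are no other zeros, and the diagonal attracts. -/
theorem exists_margin : ∃ ε > 0, ε < 1 / 2 ∧ ∀ x u, 0 < u → u < ε →
    0 < D.g x (x + u) ∧ D.g x (x - u) < 0 := by
  have hper : ∀ (n : ℤ) x y, D.g (x + n) (y + n) = D.g x y := by
    intro n x y
    have h1 : Function.Periodic (fun x => D.g x (y + n)) 1 := fun x => D.periodic_x x _
    have h2 : Function.Periodic (D.g x) 1 := fun y => D.periodic_y x y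
    have e1 := h1.int_mul n x
    have e2 := h2.int_mul n y
    simp only [mul_one] at e1 e2
    rw [e1, e2]
  have hc : Continuous fun z : ℝ × ℝ => D.gy z.1 (z.1 + z.2) :=
    D.cont_y.comp (by fun_prop : Continuous fun z : ℝ × ℝ => (z.1, z.1 + z.2))
  -- Compactness of one period gives a uniform neighbourhood of the diagonal; `hper` carries it to
  -- all `x`.
  obtain ⟨U, V, -, hV, hU, h0, hUV⟩ := generalized_tube_lemma (isCompact_Icc (a := (0 : ℝ)) (b := 1))
    (isCompact_singleton (x := (0 : ℝ))) (isOpen_lt continuous_const hc)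
    (by rintro ⟨x, u⟩ ⟨-, hu⟩
        simp only [mem_singleton_iff] at hu
        simpa [hu] using D.diag_pos x)
  obtain ⟨ε, hε, hεV⟩ := Metric.isOpen_iff.1 hV 0 (h0 rfl)
  obtain ⟨ε', hε', hlt⟩ := exists_between (lt_min hε (by norm_num : (0 : ℝ) < 1 / 2))
  rw [lt_min_iff] at hlt
  have hpos : ∀ x ∈ Icc (0 : ℝ) 1, ∀ u, |u| < ε → 0 < D.gy x (x + u) := fun x hx u hu =>
    @hUV (x, u) ⟨hU hx, hεV (by simpa using hu)⟩
  have main : ∀ x ∈ Icc (0 : ℝ) 1, ∀ u, 0 < u → u < ε' →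
      0 < D.g x (x + u) ∧ D.g x (x - u) < 0 := by
    intro x hx u hu hu'
    have hm := strictMonoOn_of_hasDerivAt (D.deriv_y x) (a := x - u) (b := x + u) fun y hy => by
      have := hpos x hx (y - x) (by rw [abs_lt]; constructor <;> linarith [hy.1, hy.2])
      rwa [add_sub_cancel] at this
    constructor
    · rw [← D.diag x]
      exact hm ⟨by linarith, by linarith⟩ ⟨by linarith, by linarith⟩ (by linarith)
    · rw [← D.diag x]
      exact hm ⟨by linarith, by linarith⟩ ⟨by linarith, by linarith⟩ (by linarith)
  refine ⟨ε', hε', hlt.2, fun x u hu hu' => ?_⟩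
  have := main (Int.fract x) ⟨Int.fract_nonneg x, (Int.fract_lt_one x).le⟩ u hu hu'
  rw [← hper ⌊x⌋, ← hper ⌊x⌋ (Int.fract x) (Int.fract x - u)] at this
  have e : Int.fract x + ⌊x⌋ = x := Int.fract_add_floor x
  have e1 : Int.fract x + u + ⌊x⌋ = x + u := by linarith
  have e2 : Int.fract x - u + ⌊x⌋ = x - u := by linarith
  rwa [e, e1, e2] at this

variable {D}

theorem Stable.eventually_exists {x₀ y₀ : ℝ} (h : D.Stable x₀ y₀) {ε : ℝ} (hε : 0 < ε) :
    ∀ᶠ x in 𝓝 x₀, ∃ y, |y - y₀| < ε ∧ D.Stable x y := by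
  obtain ⟨η, δ, hη, hηε, hδ, hδε, s, -, H⟩ := exists_graph D.cont D.cont_y D.deriv_y h.1 h.2 hε
  filter_upwards [Metric.ball_mem_nhds x₀ hδ] with x hx
  obtain ⟨h1, h2, h3, -⟩ := H x (by simpa [Real.dist_eq] using hx)
  exact ⟨s x, by linarith, h2, h3⟩

theorem eventually_abs_fst (z₀ : ℝ × ℝ) {δ : ℝ} (hδ : 0 < δ) : ∀ᶠ z in 𝓝 z₀, |z.1 - z₀.1| < δ :=
  (continuous_fst.tendsto z₀).eventually (Metric.ball_mem_nhds _ hδ)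

theorem eventually_abs_snd (z₀ : ℝ × ℝ) {δ : ℝ} (hδ : 0 < δ) : ∀ᶠ z in 𝓝 z₀, |z.2 - z₀.2| < δ :=
  (continuous_snd.tendsto z₀).eventually (Metric.ball_mem_nhds _ hδ)

theorem Stable.eventually_above {x₀ y₀ : ℝ} (h : D.Stable x₀ y₀) {ε : ℝ} (hε : 0 < ε) :
    ∀ᶠ z in 𝓝 (x₀, y₀), 0 ≤ D.g z.1 z.2 → ∃ y ≤ z.2, |y - y₀| < ε ∧ D.Stable z.1 y := by
  obtain ⟨η, δ, hη, hηε, hδ, hδε, s, -, H⟩ := exists_graph D.cont D.cont_y D.deriv_y h.1 h.2 hε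
  filter_upwards [eventually_abs_fst (x₀, y₀) hδ, eventually_abs_snd (x₀, y₀) hη] with z hx hy hg
  obtain ⟨h1, h2, h3, h4, -⟩ := H z.1 hx
  refine ⟨s z.1, ?_, by linarith, h2, h3⟩
  by_contra! hlt
  linarith [h4 z.2 hy.le hlt]

/-- Walks between neighbouring stable configurations follow this arc; by the last clause it misses
none of them. -/
theorem Stable.exists_arc {x₀ y₀ : ℝ} (h : D.Stable x₀ y₀) :
    ∃ δ > 0, ∃ c : ℝ → ℝ × ℝ, ContinuousOn c (Ioo (-δ) δ) ∧ c 0 = (x₀, y₀) ∧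
      (∀ t ∈ Ioo (-δ) δ, D.Stable (c t).1 (c t).2) ∧
      ∀ᶠ z in 𝓝 (x₀, y₀), D.Stable z.1 z.2 → ∃ t ∈ Ioo (-δ) δ, c t = z := by
  obtain ⟨η, δ, hη, -, hδ, -, s, hs, H⟩ :=
    exists_graph D.cont D.cont_y D.deriv_y h.1 h.2 zero_lt_one
  have huniq : ∀ x y, |x - x₀| < δ → |y - y₀| ≤ η → D.g x y = 0 → s x = y := by
    intro x y hx hy hxy
    obtain ⟨-, -, -, h3, h4⟩ := H x hx
    rcases lt_trichotomy y (s x) with h | h | h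
    · linarith [h3 y hy h]
    · exact h.symm
    · linarith [h4 y hy h]
  refine ⟨δ, hδ, fun t => (x₀ + t, s (x₀ + t)), ?_, ?_, ?_, ?_⟩
  · refine (by fun_prop : Continuous fun t => x₀ + t).continuousOn.prodMk
      (hs.comp (by fun_prop) fun t ht => ⟨by linarith [ht.1], by linarith [ht.2]⟩)
  · simp [huniq x₀ y₀ (by simpa) (by simpa using hη.le) h.1]
  · intro t ht
    obtain ⟨-, h2, h3, -⟩ := H (x₀ + t) (by simpa [abs_lt] using ht)
    exact ⟨h2, h3⟩
  · filter_upwards [eventually_abs_fst (x₀, y₀) hδ, eventually_abs_snd (x₀, y₀) hη] with z hx hy hz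
    refine ⟨z.1 - x₀, by simpa [abs_lt] using hx, ?_⟩
    rw [add_sub_cancel, huniq z.1 z.2 hx hy.le hz.1]

/-- The fold at a pivot, with the horizontal orientation `σ` and the vertical orientation `τ`. -/
theorem Pivot.exists_fold {x₀ y₀ : ℝ} (h : D.Pivot x₀ y₀) :
    ∃ σ τ : ℝ, (σ = 1 ∨ σ = -1) ∧ (τ = 1 ∨ τ = -1) ∧ (D.gyy x₀ y₀ < 0 → τ = 1) ∧
    ∀ ε > 0, ∃ η δ : ℝ, 0 < η ∧ η < ε ∧ 0 < δ ∧ δ < ε ∧ ∃ s : ℝ → ℝ,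
      ContinuousOn s (Ico 0 δ) ∧ s 0 = 0 ∧
      (∀ t ∈ Ioo 0 δ, (-η < s t ∧ s t < 0) ∧ D.Stable (x₀ + σ * t) (y₀ + τ * s t) ∧
        (∀ y ∈ Icc (-η) η, 0 ≤ τ * D.g (x₀ + σ * t) (y₀ + τ * y) → s t ≤ y) ∧
        ∀ y ∈ Icc (-η) η, D.Stable (x₀ + σ * t) (y₀ + τ * y) → y = s t) ∧
      ∀ t ∈ Ioc (-δ) 0, ∀ y ∈ Icc (-η) η, 0 ≤ τ * D.g (x₀ + σ * t) (y₀ + τ * y) →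
        t = 0 ∧ y = 0 := by
  obtain ⟨hx, hyy⟩ := D.generic x₀ y₀ h.1 h.2
  -- In the coordinates `x₀ + σ * t`, `y₀ + τ * y`, the sign `τ` makes the second derivative in `y`
  -- negative and `σ` makes the derivative in `t` positive. The first derivative in `y` stays `gy`,
  -- because `τ * τ = 1`, so stability is unaffected.
  obtain ⟨τ, hτ, hτ1, hτ2⟩ : ∃ τ : ℝ, (τ = 1 ∨ τ = -1) ∧ (D.gyy x₀ y₀ < 0 → τ = 1) ∧
      τ * D.gyy x₀ y₀ < 0 := by
    rcases lt_or_gt_of_ne hyy with h | h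
    · exact ⟨1, .inl rfl, fun _ => rfl, by simpa⟩
    · exact ⟨-1, .inr rfl, fun h' => by linarith, by simpa⟩
  have hττ : τ * τ = 1 := by rcases hτ with rfl | rfl <;> norm_num
  have hτ0 : τ ≠ 0 := by rintro rfl; simp at hττ
  obtain ⟨σ, hσ, hσ2⟩ : ∃ σ : ℝ, (σ = 1 ∨ σ = -1) ∧ 0 < τ * (σ * D.gx x₀ y₀) := by
    rcases lt_or_gt_of_ne (mul_ne_zero hτ0 hx) with h | h
    · exact ⟨-1, .inr rfl, by linarith⟩
    · exact ⟨1, .inl rfl, by linarith⟩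
  refine ⟨σ, τ, hσ, hτ, hτ1, fun ε hε => ?_⟩
  have hc : Continuous fun z : ℝ × ℝ => (x₀ + σ * z.1, y₀ + τ * z.2) := by fun_prop
  obtain ⟨η, δ, h1, h2, h3, h4, s, h5, h6, h7, h8⟩ := Puppy.exists_fold
    (k := fun t y => τ * D.g (x₀ + σ * t) (y₀ + τ * y))
    (kt := fun t y => τ * (σ * D.gx (x₀ + σ * t) (y₀ + τ * y)))
    (ky := fun t y => D.gy (x₀ + σ * t) (y₀ + τ * y))
    (kyy := fun t y => τ * D.gyy (x₀ + σ * t) (y₀ + τ * y))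
    ((D.cont.comp hc).const_mul τ) (((D.cont_x.comp hc).const_mul σ).const_mul τ)
    ((D.cont_yy.comp hc).const_mul τ)
    (fun t y => by
      have := ((D.deriv_x (x₀ + σ * t) (y₀ + τ * y)).comp t
        (((hasDerivAt_id t).const_mul σ).const_add x₀)).const_mul τ
      convert! this using 1
      ring)
    (fun t y => by
      have := ((D.deriv_y (x₀ + σ * t) (y₀ + τ * y)).comp y
        (((hasDerivAt_id y).const_mul τ).const_add y₀)).const_mul τ
      convert! this using 1
      linear_combination (-D.gy (x₀ + σ * t) (y₀ + τ * y)) * hττ)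
    (fun t y => by
      have := (D.deriv_yy (x₀ + σ * t) (y₀ + τ * y)).comp y
        (((hasDerivAt_id y).const_mul τ).const_add y₀)
      convert! this using 1
      ring)
    (by simp [h.1]) (by simp [h.2]) (by simpa using hτ2) (by simpa using hσ2) hε
  refine ⟨η, δ, h1, h2, h3, h4, s, h5, h6, fun t ht => ?_, h8⟩
  obtain ⟨a1, a2, a3, a4, a5⟩ := h7 t ht
  refine ⟨a1, ⟨?_, a3⟩, a4, fun y hy hst => a5 y hy (by simp [hst.1]) hst.2⟩
  simpa [hτ0] using a2

/-- Only one of the two branches of a fold is stable. The arc is therefore half-open, starting at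
the pivot, and a walk along it can end there. -/
theorem Pivot.exists_arc {x₀ y₀ : ℝ} (h : D.Pivot x₀ y₀) :
    ∃ δ > 0, ∃ c : ℝ → ℝ × ℝ, ContinuousOn c (Ico 0 δ) ∧ c 0 = (x₀, y₀) ∧
      (∀ t ∈ Ioo 0 δ, D.Stable (c t).1 (c t).2) ∧
      ∀ᶠ z in 𝓝 (x₀, y₀), D.Stable z.1 z.2 → ∃ t ∈ Ioo 0 δ, c t = z := by
  obtain ⟨σ, τ, hσ, hτ, -, H⟩ := h.exists_fold
  obtain ⟨η, δ, hη, -, hδ, -, s, hs, hs0, h1, h2⟩ := H 1 one_pos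
  refine ⟨δ, hδ, fun t => (x₀ + σ * t, y₀ + τ * s t), ?_, by simp [hs0], fun t ht => (h1 t ht).2.1,
    ?_⟩
  · exact (by fun_prop : Continuous fun t => x₀ + σ * t).continuousOn.prodMk
      (by fun_prop)
  · filter_upwards [eventually_abs_fst (x₀, y₀) hδ, eventually_abs_snd (x₀, y₀) hη] with z hx hy hz
    have hσσ : σ * σ = 1 := by rcases hσ with rfl | rfl <;> norm_num
    have hττ : τ * τ = 1 := by rcases hτ with rfl | rfl <;> norm_num
    have ex : x₀ + σ * (σ * (z.1 - x₀)) = z.1 := by linear_combination (z.1 - x₀) * hσσ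
    have ey : y₀ + τ * (τ * (z.2 - y₀)) = z.2 := by linear_combination (z.2 - y₀) * hττ
    have hx' : |σ * (z.1 - x₀)| < δ := by rcases hσ with rfl | rfl <;> simpa [abs_sub_comm] using hx
    have hy' : |τ * (z.2 - y₀)| < η := by rcases hτ with rfl | rfl <;> simpa [abs_sub_comm] using hy
    rw [abs_lt] at hx' hy'
    have hpos : 0 < σ * (z.1 - x₀) := by
      by_contra! hle
      obtain ⟨e1, e2⟩ := h2 _ ⟨hx'.1, hle⟩ (τ * (z.2 - y₀)) ⟨hy'.1.le, hy'.2.le⟩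
        (by rw [ex, ey, hz.1, mul_zero])
      rw [e1, mul_zero, add_zero] at ex
      rw [e2, mul_zero, add_zero] at ey
      have := hz.2
      rw [← ex, ← ey, h.2] at this
      exact lt_irrefl _ this
    refine ⟨σ * (z.1 - x₀), ⟨hpos, hx'.2⟩, ?_⟩
    have := (h1 _ ⟨hpos, hx'.2⟩).2.2.2 (τ * (z.2 - y₀)) ⟨hy'.1.le, hy'.2.le⟩ (by rwa [ex, ey])
    simp only [← this, ex, ey]

/-- At a forward pivot all nearby points with `0 ≤ g` lie on one side. -/
theorem Pivot.exists_side {x₀ y₀ : ℝ} (h : D.Pivot x₀ y₀) (hf : D.gyy x₀ y₀ < 0) :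
    ∃ σ : ℝ, (σ = 1 ∨ σ = -1) ∧
      (∀ᶠ z in 𝓝 (x₀, y₀), 0 ≤ D.g z.1 z.2 → z = (x₀, y₀) ∨ 0 < σ * (z.1 - x₀)) ∧
      (∀ ε > 0, ∀ᶠ x in 𝓝 x₀, 0 < σ * (x - x₀) → ∃ y, |y - y₀| < ε ∧ D.Stable x y) ∧
      ∀ ε > 0, ∀ᶠ z in 𝓝 (x₀, y₀), 0 ≤ D.g z.1 z.2 → 0 < σ * (z.1 - x₀) →
        ∃ y ≤ z.2, |y - y₀| < ε ∧ D.Stable z.1 y := by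
  obtain ⟨σ, τ, hσ, -, hτ, H⟩ := h.exists_fold
  obtain rfl := hτ hf
  have hσσ : σ * σ = 1 := by rcases hσ with rfl | rfl <;> norm_num
  have ex : ∀ x, x₀ + σ * (σ * (x - x₀)) = x := fun x => by linear_combination (x - x₀) * hσσ
  have hab : ∀ {x δ}, |x - x₀| < δ → |σ * (x - x₀)| < δ := fun {x δ} hx => by
    rcases hσ with rfl | rfl <;> simpa [abs_sub_comm] using hx
  refine ⟨σ, hσ, ?_, fun ε hε => ?_, fun ε hε => ?_⟩
  · obtain ⟨η, δ, hη, -, hδ, -, s, hs, hs0, h1, h2⟩ := H 1 one_pos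
    filter_upwards [eventually_abs_fst (x₀, y₀) hδ, eventually_abs_snd (x₀, y₀) hη] with z hx hy hz
    by_contra! hcon
    have hx' := hab hx
    rw [abs_lt] at hx'
    obtain ⟨e1, e2⟩ := h2 _ ⟨hx'.1, hcon.2⟩ (z.2 - y₀) (abs_le.1 hy.le)
      (by simpa [ex] using hz)
    refine hcon.1 (Prod.ext ?_ (by simpa [sub_eq_zero] using e2))
    have := ex z.1
    rw [e1, mul_zero, add_zero] at this
    exact this.symm
  · obtain ⟨η, δ, hη, hηε, hδ, -, s, hs, hs0, h1, h2⟩ := H ε hε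
    filter_upwards [Metric.ball_mem_nhds x₀ hδ] with x hx hpos
    have hx' := hab (by simpa [Real.dist_eq] using hx)
    obtain ⟨a1, a2, -⟩ := h1 _ ⟨hpos, (abs_lt.1 hx').2⟩
    rw [ex] at a2
    refine ⟨_, ?_, a2⟩
    rw [one_mul, add_sub_cancel_left, abs_lt]
    constructor <;> linarith
  · obtain ⟨η, δ, hη, hηε, hδ, -, s, hs, hs0, h1, h2⟩ := H ε hε
    filter_upwards [eventually_abs_fst (x₀, y₀) hδ, eventually_abs_snd (x₀, y₀) hη]
      with z hx hy hz hpos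
    have hx' := hab hx
    obtain ⟨a1, a2, a3, -⟩ := h1 _ ⟨hpos, (abs_lt.1 hx').2⟩
    rw [ex] at a2 a3
    refine ⟨_, ?_, ?_, a2⟩
    · have := a3 (z.2 - y₀) (abs_le.1 hy.le) (by simpa using hz)
      linarith
    · rw [one_mul, add_sub_cancel_left, abs_lt]
      constructor <;> linarith

end Attraction

end Puppy

/-! ### Traps, and the part of `{0 ≤ g}` above a trap -/

namespace Puppy

open Set Filter Topology

namespace Attraction

/-- A set of stable points in the open strip `x < y < x + 1` that can be left neither by walks nor
by the runs from pivots. -/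
structure IsTrap (D : Attraction) (R : Set (ℝ × ℝ)) : Prop where
  nonempty : R.Nonempty
  strip : ∀ x y, (x, y) ∈ R → x < y ∧ y < x + 1
  stable : ∀ x y, (x, y) ∈ R → D.Stable x y
  periodic : ∀ x y, (x + 1, y + 1) ∈ R ↔ (x, y) ∈ R
  near : ∀ x y, x < y → y < x + 1 → D.Stable x y ∨ D.Pivot x y → (x, y) ∈ closure R →
    ∀ᶠ z in 𝓝 (x, y), D.Stable z.1 z.2 → z ∈ R
  forward : ∀ x y, x < y → y < x + 1 → D.Pivot x y → D.gyy x y < 0 → (x, y) ∈ closure R →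
    ∃ w > y, (x, w) ∈ R ∧ ∀ t ∈ Ioo y w, D.g x t < 0 ∨ D.Pivot x t ∧ D.gyy x t < 0
  backward : ∀ x y, x < y → y < x + 1 → D.Pivot x y → 0 < D.gyy x y → (x, y) ∈ closure R →
    ∃ w < y, (x, w) ∈ R ∧ ∀ t ∈ Ioo w y, 0 < D.g x t ∨ D.Pivot x t ∧ 0 < D.gyy x t

/-- The part of `{0 ≤ g}` above a set `R`. -/
def upperPart (D : Attraction) (R : Set (ℝ × ℝ)) : Set (ℝ × ℝ) :=
  closure {z | 0 ≤ D.g z.1 z.2 ∧ ∃ y ≤ z.2, (z.1, y) ∈ R}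

variable {D : Attraction} {R : Set (ℝ × ℝ)}

theorem zero_margin {ε : ℝ} (H : ∀ x u, 0 < u → u < ε → 0 < D.g x (x + u) ∧ D.g x (x - u) < 0)
    {x y : ℝ} (h1 : x < y) (h2 : y < x + 1) (h3 : D.g x y = 0) : x + ε ≤ y ∧ y ≤ x + 1 - ε := by
  constructor
  · by_contra! hlt
    have := (H x (y - x) (by linarith) (by linarith)).1
    rw [add_sub_cancel] at this
    linarith
  · by_contra! hlt
    have := (H x (x + 1 - y) (by linarith) (by linarith)).2
    rw [← D.periodic_y, show x - (x + 1 - y) + 1 = y by ring] at this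
    linarith

theorem IsTrap.margin (hR : D.IsTrap R) {ε : ℝ}
    (H : ∀ x u, 0 < u → u < ε → 0 < D.g x (x + u) ∧ D.g x (x - u) < 0) :
    ∀ z ∈ R, z.1 + ε ≤ z.2 ∧ z.2 ≤ z.1 + 1 - ε := fun z hz =>
  zero_margin H (hR.strip z.1 z.2 hz).1 (hR.strip z.1 z.2 hz).2 (hR.stable z.1 z.2 hz).1

/-- The zeros of `g` in the open strip keep a uniform vertical distance from its boundary lines. -/
theorem IsTrap.strip_closure (hR : D.IsTrap R) {x y : ℝ} (h : (x, y) ∈ closure R) :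
    x < y ∧ y < x + 1 := by
  obtain ⟨ε, hε, -, H⟩ := D.exists_margin
  have hc : IsClosed ({z : ℝ × ℝ | z.1 + ε ≤ z.2} ∩ {z : ℝ × ℝ | z.2 ≤ z.1 + 1 - ε}) :=
    (isClosed_le (by fun_prop) (by fun_prop)).inter (isClosed_le (by fun_prop) (by fun_prop))
  have : x + ε ≤ y ∧ y ≤ x + 1 - ε := closure_minimal (hR.margin H) hc h
  constructor <;> linarith

/-- Limits of stable points satisfy `g = 0` and `0 ≤ gy`; if `0 < gy`, the point is itself one of
the stable points to which `near` applies. -/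
theorem IsTrap.mem_or_pivot (hR : D.IsTrap R) {x y : ℝ} (h : (x, y) ∈ closure R) :
    (x, y) ∈ R ∨ D.Pivot x y := by
  have hc : IsClosed ({z : ℝ × ℝ | D.g z.1 z.2 = 0} ∩ {z : ℝ × ℝ | 0 ≤ D.gy z.1 z.2}) :=
    (isClosed_eq D.cont continuous_const).inter (isClosed_le continuous_const D.cont_y)
  have hsub : R ⊆ {z : ℝ × ℝ | D.g z.1 z.2 = 0} ∩ {z : ℝ × ℝ | 0 ≤ D.gy z.1 z.2} := fun z hz =>
    ⟨(hR.stable z.1 z.2 hz).1, (hR.stable z.1 z.2 hz).2.le⟩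
  have h1 : D.g x y = 0 ∧ 0 ≤ D.gy x y := closure_minimal hsub hc h
  obtain ⟨s1, s2⟩ := hR.strip_closure h
  rcases h1.2.eq_or_lt with h2 | h2
  · exact .inr ⟨h1.1, h2.symm⟩
  · exact .inl ((hR.near x y s1 s2 (.inl ⟨h1.1, h2⟩) h).self_of_nhds ⟨h1.1, h2⟩)

theorem IsTrap.near' (hR : D.IsTrap R) {x y : ℝ} (h : (x, y) ∈ closure R) :
    ∃ r > 0, ∀ x' y', |x' - x| < r → |y' - y| < r → D.Stable x' y' → (x', y') ∈ R := by
  obtain ⟨s1, s2⟩ := hR.strip_closure h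
  have hsp : D.Stable x y ∨ D.Pivot x y := (hR.mem_or_pivot h).imp_left (hR.stable x y)
  obtain ⟨r, hr, H⟩ := Metric.eventually_nhds_iff.1 (hR.near x y s1 s2 hsp h)
  refine ⟨r, hr, fun x' y' hx hy => @H (x', y') ?_⟩
  rw [Prod.dist_eq, Real.dist_eq, Real.dist_eq]
  exact max_lt hx hy

/-- The run from a limit pivot lands in `R` on the same vertical line. This carries a trap past the
folds. -/
theorem IsTrap.exists_of_closure (hR : D.IsTrap R) {x y : ℝ} (h : (x, y) ∈ closure R) :
    ∃ w, (x, w) ∈ R := by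
  obtain ⟨s1, s2⟩ := hR.strip_closure h
  rcases hR.mem_or_pivot h with h1 | h1
  · exact ⟨y, h1⟩
  · rcases lt_or_gt_of_ne (D.generic x y h1.1 h1.2).2 with h2 | h2
    · obtain ⟨w, -, hw, -⟩ := hR.forward x y s1 s2 h1 h2 h
      exact ⟨w, hw⟩
    · obtain ⟨w, -, hw, -⟩ := hR.backward x y s1 s2 h1 h2 h
      exact ⟨w, hw⟩

/-- A trap meets every vertical line. -/
theorem IsTrap.exists_mem (hR : D.IsTrap R) (x : ℝ) : ∃ y, (x, y) ∈ R := by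
  suffices h : {x | ∃ y, (x, y) ∈ R} = univ from
    (Set.ext_iff.1 h x).2 (mem_univ x)
  -- The projection of `R` is closed by compactness and `exists_of_closure`, and open because stable
  -- arcs are graphs over `x`.
  refine IsClopen.eq_univ ⟨?_, ?_⟩ ?_
  · refine isClosed_of_closure_subset fun a ha => ?_
    obtain ⟨u, hu, hlim⟩ := mem_closure_iff_seq_limit.1 ha
    choose v hv using hu
    have hev : ∀ᶠ n in atTop, v n ∈ Icc (a - 1) (a + 2) := by
      filter_upwards [hlim.eventually (Metric.ball_mem_nhds a one_pos)] with n hn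
      rw [Real.dist_eq, abs_lt] at hn
      have := hR.strip _ _ (hv n)
      constructor <;> linarith
    obtain ⟨b, -, φ, hφ, hb⟩ := isCompact_Icc.tendsto_subseq' hev.frequently
    refine hR.exists_of_closure (y := b) (mem_closure_of_tendsto
      ((hlim.comp hφ.tendsto_atTop).prodMk_nhds hb) (Eventually.of_forall fun n => hv (φ n)))
  · rw [isOpen_iff_mem_nhds]
    rintro a ⟨b, hb⟩
    obtain ⟨r, hr, H⟩ := hR.near' (subset_closure hb)
    filter_upwards [(hR.stable a b hb).eventually_exists hr, Metric.ball_mem_nhds a hr] with z hz hz'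
    obtain ⟨y, hy, hst⟩ := hz
    exact ⟨y, H z y (by simpa [Real.dist_eq] using hz') hy hst⟩
  · obtain ⟨z, hz⟩ := hR.nonempty
    exact ⟨z.1, z.2, hz⟩

theorem isClosed_upperPart : IsClosed (D.upperPart R) := isClosed_closure

theorem nonneg_of_mem_upperPart {z : ℝ × ℝ} (h : z ∈ D.upperPart R) : 0 ≤ D.g z.1 z.2 :=
  closure_minimal (fun _ hz => hz.1) (isClosed_le continuous_const D.cont) h

theorem mem_upperPart {z : ℝ × ℝ} (h : 0 ≤ D.g z.1 z.2) {y : ℝ} (hy : y ≤ z.2)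
    (hz : (z.1, y) ∈ R) : z ∈ D.upperPart R := subset_closure ⟨h, y, hy, hz⟩

theorem upperPart_margin {ε : ℝ}
    (hε : ∀ z ∈ R, z.1 + ε ≤ z.2 ∧ z.2 ≤ z.1 + 1 - ε) {z : ℝ × ℝ} (h : z ∈ D.upperPart R) :
    z.1 + ε ≤ z.2 := by
  refine closure_minimal (t := {z : ℝ × ℝ | z.1 + ε ≤ z.2}) ?_
    (isClosed_le (by fun_prop) (by fun_prop)) h
  rintro w ⟨-, y, hy, hw⟩
  exact (hε _ hw).1.trans hy

theorem IsTrap.upperPart_periodic (hR : D.IsTrap R) (x y : ℝ) :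
    (x + 1, y + 1) ∈ D.upperPart R ↔ (x, y) ∈ D.upperPart R := by
  let e : ℝ × ℝ ≃ₜ ℝ × ℝ := Homeomorph.addRight (1, 1)
  have : e ⁻¹' D.upperPart R = D.upperPart R := by
    rw [upperPart, e.preimage_closure]
    congr 1
    ext ⟨x, y⟩
    have hg : D.g (x + 1) (y + 1) = D.g x y := by rw [D.periodic_x, D.periodic_y]
    simp only [e, mem_preimage, Homeomorph.coe_addRight, Prod.mk_add_mk, mem_ofPred_eq, hg]
    refine and_congr_right fun _ => ⟨?_, ?_⟩
    · rintro ⟨w, hw, hm⟩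
      refine ⟨w - 1, by linarith, (hR.periodic _ _).1 ?_⟩
      rwa [sub_add_cancel]
    · rintro ⟨w, hw, hm⟩
      exact ⟨w + 1, by linarith, (hR.periodic _ _).2 hm⟩
  exact Set.ext_iff.1 this (x, y)

theorem IsTrap.eventually_of_lt (hR : D.IsTrap R) {x y w : ℝ} (hw : (x, w) ∈ R) (hwy : w < y) :
    ∀ᶠ z in 𝓝 (x, y), ∃ v ≤ z.2, (z.1, v) ∈ R := by
  obtain ⟨r, hr, H⟩ := hR.near' (subset_closure hw)
  have h1 := (hR.stable x w hw).eventually_exists (lt_min hr (by linarith : 0 < (y - w) / 2))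
  filter_upwards [(continuous_fst.tendsto (x, y)).eventually h1, eventually_abs_fst (x, y) hr,
    eventually_abs_snd (x, y) (by linarith : 0 < (y - w) / 2)] with z hz hx hy
  obtain ⟨v, hv, hst⟩ := hz
  rw [lt_min_iff] at hv
  refine ⟨v, ?_, H _ _ hx hv.1 hst⟩
  have e1 := (abs_lt.1 hv.2).2
  have e2 := (abs_lt.1 hy).1
  linarith

theorem IsTrap.eventually_of_mem (hR : D.IsTrap R) {x y : ℝ} (h : (x, y) ∈ R) :
    ∀ᶠ z in 𝓝 (x, y), 0 ≤ D.g z.1 z.2 → ∃ v ≤ z.2, (z.1, v) ∈ R := by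
  obtain ⟨r, hr, H⟩ := hR.near' (subset_closure h)
  filter_upwards [(hR.stable x y h).eventually_above hr, eventually_abs_fst (x, y) hr]
    with z hz hx hg
  obtain ⟨v, hv, hvr, hst⟩ := hz hg
  exact ⟨v, hv, H _ _ hx hvr hst⟩

/-- A point of the closure need not have a point of `R` below it; a limit `b` of points below its
approximants takes that role. The clause on `U` and `V` keeps an approximant together with its point
of `R`, since their common abscissa tells on which side of a pivot both lie. -/
theorem IsTrap.exists_below (hR : D.IsTrap R) {x y : ℝ} (h : (x, y) ∈ D.upperPart R) :
    ∃ b ≤ y, (x, b) ∈ closure R ∧ ∀ U ∈ 𝓝 (x, y), ∀ V ∈ 𝓝 (x, b), ∃ z v,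
      z ∈ U ∧ 0 ≤ D.g z.1 z.2 ∧ (z.1, v) ∈ V ∧ (z.1, v) ∈ R ∧ v ≤ z.2 := by
  obtain ⟨u, hu, hlim⟩ := mem_closure_iff_seq_limit.1 h
  choose hu0 v hvu hv using hu
  have hl1 : Tendsto (fun n => (u n).1) atTop (𝓝 x) := (continuous_fst.tendsto _).comp hlim
  have hl2 : Tendsto (fun n => (u n).2) atTop (𝓝 y) := (continuous_snd.tendsto _).comp hlim
  have hev : ∀ᶠ n in atTop, v n ∈ Icc (x - 1) (y + 1) := by
    filter_upwards [hl1.eventually (lt_mem_nhds (by linarith : x - 1 < x)),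
      hl2.eventually (gt_mem_nhds (by linarith : y < y + 1))] with n h1 h2
    have := hR.strip _ _ (hv n)
    have := hvu n
    constructor <;> linarith
  obtain ⟨b, -, φ, hφ, hb⟩ := isCompact_Icc.tendsto_subseq' hev.frequently
  have hb' : Tendsto (fun n => ((u (φ n)).1, v (φ n))) atTop (𝓝 (x, b)) :=
    (hl1.comp hφ.tendsto_atTop).prodMk_nhds hb
  refine ⟨b, le_of_tendsto_of_tendsto' hb (hl2.comp hφ.tendsto_atTop) fun n => hvu _,
    mem_closure_of_tendsto hb' (Eventually.of_forall fun n => hv _), fun U hU V hV => ?_⟩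
  obtain ⟨n, h1, h2⟩ := (((hlim.comp hφ.tendsto_atTop).eventually hU).and
    (hb'.eventually hV)).exists
  exact ⟨u (φ n), v (φ n), h1, hu0 _, h2, hv _, hvu _⟩

/-- The part of `{0 ≤ g}` above a trap is relatively open. -/
theorem IsTrap.eventually_mem_upperPart (hR : D.IsTrap R) {p : ℝ × ℝ} (h : p ∈ D.upperPart R) :
    ∀ᶠ z in 𝓝 p, 0 ≤ D.g z.1 z.2 → z ∈ D.upperPart R := by
  obtain ⟨x, y⟩ := p
  have caseLt : ∀ w, (x, w) ∈ R → w < y →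
      ∀ᶠ z in 𝓝 (x, y), 0 ≤ D.g z.1 z.2 → z ∈ D.upperPart R := fun w hw hwy => by
    filter_upwards [hR.eventually_of_lt hw hwy] with z hz hg
    obtain ⟨v, hv, hvR⟩ := hz
    exact mem_upperPart hg hv hvR
  have caseEq : (x, y) ∈ R →
      ∀ᶠ z in 𝓝 (x, y), 0 ≤ D.g z.1 z.2 → z ∈ D.upperPart R := fun hw => by
    filter_upwards [hR.eventually_of_mem hw] with z hz hg
    obtain ⟨v, hv, hvR⟩ := hz hg
    exact mem_upperPart hg hv hvR
  have caseLe : ∀ w, (x, w) ∈ R → w ≤ y →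
      ∀ᶠ z in 𝓝 (x, y), 0 ≤ D.g z.1 z.2 → z ∈ D.upperPart R := fun w hw hwy => by
    rcases hwy.eq_or_lt with rfl | hlt
    · exact caseEq hw
    · exact caseLt w hw hlt
  obtain ⟨b, hby, hb, happ⟩ := hR.exists_below h
  obtain ⟨s1, s2⟩ := hR.strip_closure hb
  rcases hR.mem_or_pivot hb with hbR | hbp
  · exact caseLe b hbR hby
  rcases lt_or_gt_of_ne (D.generic x b hbp.1 hbp.2).2 with hf | hf
  swap
  · obtain ⟨w, hwb, hw, -⟩ := hR.backward x b s1 s2 hbp hf hb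
    exact caseLe w hw (by linarith)
  obtain ⟨w, hwb, hw, hbet⟩ := hR.forward x b s1 s2 hbp hf hb
  rcases le_or_gt w y with hwy | hwy
  · exact caseLe w hw hwy
  -- Strictly between `b` and `w` the run meets only `g < 0` and forward pivots, whereas `0 ≤ g` at
  -- `(x, y)`.
  have hyp : D.Pivot x y ∧ D.gyy x y < 0 := by
    rcases hby.eq_or_lt with rfl | hlt
    · exact ⟨hbp, hf⟩
    · exact (hbet y ⟨hlt, hwy⟩).resolve_left (not_lt.2 (nonneg_of_mem_upperPart h))
  obtain ⟨σ, hσ, hσ1, hσ2, hσ3⟩ := hbp.exists_side hf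
  obtain ⟨σ', hσ', hσ1', -, -⟩ := hyp.1.exists_side hyp.2
  obtain ⟨z, v, hz, hg, hzv, hvR, -⟩ := happ _ hσ1' _ hσ1
  have hst := hR.stable _ _ hvR
  have hside : 0 < σ * (z.1 - x) := by
    rcases hzv hst.1.ge with h1 | h1
    · simp only [Prod.mk.injEq] at h1
      rw [h1.1, h1.2] at hst
      exact absurd hbp.2 hst.2.ne'
    · exact h1
  have hside' : 0 < σ' * (z.1 - x) := by
    rcases hz hg with h1 | h1
    · simp [h1] at hside
    · exact h1
  -- The approximant and its point of `R` have the same abscissa, so the folds at `(x, y)` and `(x,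
  -- b)` open to the same side. Over that side the stable branch issuing from `(x, b)` belongs to
  -- `R`.
  have hσσ : σ' = σ := by
    rcases hσ with rfl | rfl <;> rcases hσ' with rfl | rfl <;> first | rfl | (exfalso; linarith)
  subst hσσ
  obtain ⟨r, hr, H⟩ := hR.near' hb
  rcases hby.eq_or_lt with rfl | hlt
  · filter_upwards [hσ1, hσ3 r hr, eventually_abs_fst (x, b) hr] with z h1 h2 hx hg
    rcases h1 hg with rfl | h1
    · exact h
    · obtain ⟨v, hv, hvr, hst⟩ := h2 hg h1
      exact mem_upperPart hg hv (H _ _ hx hvr hst)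
  · have h2 := hσ2 _ (lt_min hr (by linarith : 0 < (y - b) / 2))
    filter_upwards [hσ1', (continuous_fst.tendsto (x, y)).eventually h2,
      eventually_abs_fst (x, y) hr, eventually_abs_snd (x, y) (by linarith : 0 < (y - b) / 2)]
      with z h1 h2 hx hy hg
    rcases h1 hg with rfl | h1
    · exact h
    · obtain ⟨v, hv, hst⟩ := h2 h1
      rw [lt_min_iff] at hv
      refine mem_upperPart hg ?_ (H _ _ hx hv.1 hst)
      have e1 := (abs_lt.1 hv.2).2
      have e2 := (abs_lt.1 hy).1
      linarith

theorem IsTrap.isClosed_diff_upperPart (hR : D.IsTrap R) :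
    IsClosed ({z | 0 ≤ D.g z.1 z.2} \ D.upperPart R) := by
  rw [← isOpen_compl_iff, isOpen_iff_mem_nhds]
  intro p hp
  by_cases h : 0 ≤ D.g p.1 p.2
  · have hp' : p ∈ D.upperPart R := by
      by_contra h'
      exact hp ⟨h, h'⟩
    filter_upwards [hR.eventually_mem_upperPart hp'] with z hz hz'
    exact hz'.2 (hz hz'.1)
  · filter_upwards [D.cont.continuousAt.eventually (gt_mem_nhds (not_le.1 h))] with z hz hz'
    exact not_lt.2 hz'.1 hz

/-- Reflection of the plane that exchanges the two boundary lines of the strip. -/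
def flip : ℝ × ℝ ≃ₜ ℝ × ℝ :=
  (Homeomorph.neg ℝ).prodCongr (Homeomorph.subLeft 1)

@[simp] theorem flip_mk (x y : ℝ) : flip (x, y) = (-x, 1 - y) := rfl

/-- Reversing the track exchanges forward and backward runs, so facts about the part below a trap
follow from those about the part above. -/
theorem IsTrap.reflect (hR : D.IsTrap R) : D.reflect.IsTrap (flip ⁻¹' R) := by
  have hcl : ∀ x y, (x, y) ∈ closure (flip ⁻¹' R) → (-x, 1 - y) ∈ closure R := fun x y h => by
    rwa [← flip.preimage_closure] at h
  have hyy : ∀ x y, D.reflect.gyy x y = -D.gyy (-x) (1 - y) := fun _ _ => rfl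
  have hg : ∀ x y, D.reflect.g x y = -D.g (-x) (1 - y) := fun _ _ => rfl
  have hst : ∀ x y, D.reflect.Stable x y ↔ D.Stable (-x) (1 - y) := fun x y =>
    and_congr_left fun _ => neg_eq_zero
  have hpv : ∀ x y, D.reflect.Pivot x y ↔ D.Pivot (-x) (1 - y) := fun x y =>
    and_congr_left fun _ => neg_eq_zero
  constructor
  · obtain ⟨z, hz⟩ := hR.nonempty
    exact ⟨flip.symm z, by simpa using hz⟩
  · intro x y h
    have := hR.strip (-x) (1 - y) h
    constructor <;> linarith
  · intro x y h
    exact (hst x y).2 (hR.stable _ _ h)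
  · intro x y
    rw [mem_preimage, mem_preimage, flip_mk, flip_mk, ← hR.periodic]
    ring_nf
  · intro x y h1 h2 h3 h4
    rw [hst, hpv] at h3
    have := hR.near _ _ (by linarith) (by linarith) h3 (hcl x y h4)
    filter_upwards [(flip.continuous.tendsto (x, y)).eventually this] with z hz hz'
    exact hz ((hst z.1 z.2).1 hz')
  · intro x y h1 h2 h3 h4 h5
    rw [hpv] at h3
    rw [hyy, neg_lt_zero] at h4
    obtain ⟨w, hw, hwR, H⟩ := hR.backward _ _ (by linarith) (by linarith) h3 h4 (hcl x y h5)
    refine ⟨1 - w, by linarith, by simpa using hwR, fun t ht => ?_⟩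
    rw [hg, hpv, hyy, neg_lt_zero, neg_lt_zero]
    exact H _ ⟨by linarith [ht.2], by linarith [ht.1]⟩
  · intro x y h1 h2 h3 h4 h5
    rw [hpv] at h3
    rw [hyy, neg_pos] at h4
    obtain ⟨w, hw, hwR, H⟩ := hR.forward _ _ (by linarith) (by linarith) h3 h4 (hcl x y h5)
    refine ⟨1 - w, by linarith, by simpa using hwR, fun t ht => ?_⟩
    rw [hg, hpv, hyy, neg_pos, neg_pos]
    exact H _ ⟨by linarith [ht.2], by linarith [ht.1]⟩

end Attraction

end Puppy

namespace Puppy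

open Set Filter Topology

/-! ### Essential critical cycles -/

/-- The projection of the plane onto the torus. -/
def toTorus (z : ℝ × ℝ) : Config := ((z.1 : UnitAddCircle), (z.2 : UnitAddCircle))

theorem continuous_toTorus : Continuous toTorus :=
  ((AddCircle.continuous_mk' 1).comp continuous_fst).prodMk
    ((AddCircle.continuous_mk' 1).comp continuous_snd)

theorem isOpenMap_toTorus : IsOpenMap toTorus :=
  QuotientAddGroup.isOpenMap_coe.prodMap QuotientAddGroup.isOpenMap_coe

theorem toTorus_add_int (x y : ℝ) (m n : ℤ) : toTorus (x + m, y + n) = toTorus (x, y) := by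
  refine Prod.ext ?_ ?_ <;> refine Eq.symm (coe_eq_coe_iff_exists_int.2 ?_)
  · exact ⟨m, by simp⟩
  · exact ⟨n, by simp⟩

theorem exists_toTorus (p : Config) : ∃ x y : ℝ, x ≤ y ∧ y < x + 1 ∧ toTorus (x, y) = p := by
  obtain ⟨x, hx⟩ : ∃ x : ℝ, (x : UnitAddCircle) = p.1 := QuotientAddGroup.mk_surjective _
  obtain ⟨y, hy⟩ : ∃ y : ℝ, (y : UnitAddCircle) = p.2 := QuotientAddGroup.mk_surjective _
  refine ⟨x, x + Int.fract (y - x), ?_, ?_, ?_⟩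
  · linarith [Int.fract_nonneg (y - x)]
  · linarith [Int.fract_lt_one (y - x)]
  · have : toTorus (x, y) = p := Prod.ext hx hy
    rw [← this, ← toTorus_add_int x _ 0 ⌊y - x⌋]
    congr 2
    · simp
    · linarith [Int.fract_add_floor (y - x)]

theorem mem_add_int {Y : Set (ℝ × ℝ)} (hY : ∀ x y, (x + 1, y + 1) ∈ Y ↔ (x, y) ∈ Y) (x y : ℝ)
    (n : ℤ) : (x + n, y + n) ∈ Y ↔ (x, y) ∈ Y := by
  have hp : Function.Periodic (fun t : ℝ => (x + t, y + t) ∈ Y) 1 := fun t => by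
    simpa [add_assoc] using hY (x + t) (y + t)
  have := hp.int_mul n 0
  simpa using this

/-- Points of the open strip with the same image differ by an integer multiple of `(1, 1)`. -/
theorem mem_of_toTorus_mem {Y : Set (ℝ × ℝ)} (hY : ∀ x y, (x + 1, y + 1) ∈ Y ↔ (x, y) ∈ Y)
    (hstrip : ∀ x y, (x, y) ∈ Y → x < y ∧ y < x + 1) {x y : ℝ} (hx : x < y) (hy : y < x + 1)
    (h : toTorus (x, y) ∈ toTorus '' Y) : (x, y) ∈ Y := by
  obtain ⟨⟨x', y'⟩, hmem, he⟩ := h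
  obtain ⟨m, hm⟩ := coe_eq_coe_iff_exists_int.1 (Prod.ext_iff.1 he).1
  obtain ⟨n, hn⟩ := coe_eq_coe_iff_exists_int.1 (Prod.ext_iff.1 he).2
  obtain ⟨s1, s2⟩ := hstrip _ _ hmem
  simp only at hm hn
  have h1 : (n : ℝ) - m < 1 := by linarith
  have h2 : -1 < (n : ℝ) - m := by linarith
  have hmn : n = m := by
    have h1' : n - m < 1 := by exact_mod_cast h1
    have h2' : -1 < n - m := by exact_mod_cast h2
    omega
  subst hmn
  rw [show x = x' + n by linarith, show y = y' + n by linarith]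
  exact (mem_add_int hY _ _ _).2 hmem

theorem isClosed_image_toTorus {Y : Set (ℝ × ℝ)} (hc : IsClosed Y)
    (hY : ∀ x y, (x + 1, y + 1) ∈ Y ↔ (x, y) ∈ Y)
    (hstrip : ∀ x y, (x, y) ∈ Y → x < y ∧ y < x + 1) : IsClosed (toTorus '' Y) := by
  -- The box contains a fundamental domain of the strip under the shift by `(1, 1)`.
  have : toTorus '' Y = toTorus '' (Y ∩ Icc (0 : ℝ) 1 ×ˢ Icc (0 : ℝ) 2) := by
    refine subset_antisymm ?_ (image_mono inter_subset_left)
    rintro _ ⟨⟨x, y⟩, h, rfl⟩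
    have h' : (x + (-⌊x⌋ : ℤ), y + (-⌊x⌋ : ℤ)) ∈ Y := (mem_add_int hY _ _ _).2 h
    refine ⟨_, ⟨h', ?_⟩, toTorus_add_int _ _ _ _⟩
    obtain ⟨s1, s2⟩ := hstrip _ _ h'
    have e1 := Int.floor_le x
    have e2 := Int.lt_floor_add_one x
    push_cast at s1 s2 ⊢
    refine ⟨⟨?_, ?_⟩, ⟨?_, ?_⟩⟩ <;> simp only <;> linarith
  rw [this]
  exact (((isCompact_Icc.prod isCompact_Icc).inter_left hc).image continuous_toTorus).isClosed

theorem disjoint_image_toTorus_diag {Y : Set (ℝ × ℝ)}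
    (hY : ∀ x y, (x, y) ∈ Y → x < y ∧ y < x + 1) :
    Disjoint (toTorus '' Y) {p : Config | p.1 = p.2} := by
  rw [disjoint_left]
  rintro _ ⟨⟨x, y⟩, h, rfl⟩ hd
  obtain ⟨n, hn⟩ := coe_eq_coe_iff_exists_int.1 (show (x : UnitAddCircle) = y from hd)
  obtain ⟨h1, h2⟩ := hY x y h
  have h3 : (0 : ℤ) < n := by
    have : (0 : ℝ) < n := by linarith
    exact_mod_cast this
  have h4 : n < (1 : ℤ) := by
    have : (n : ℝ) < 1 := by linarith
    exact_mod_cast this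
  omega

theorem connectedComponentIn_ne {X : Type*} [TopologicalSpace X] {Z K L : Set X} (hK : IsClosed K)
    (hL : IsClosed L) (hd : Disjoint K L) (hZ : Z ⊆ K ∪ L) {p q : X} (hpZ : p ∈ Z) (hqZ : q ∈ Z)
    (hp : p ∈ K) (hq : q ∈ L) : connectedComponentIn Z p ≠ connectedComponentIn Z q := by
  intro he
  have hpre : IsPreconnected (connectedComponentIn Z p) := isPreconnected_connectedComponentIn
  obtain ⟨r, -, hr⟩ := isPreconnected_closed_iff.1 hpre K L hK hL
    ((connectedComponentIn_subset Z p).trans hZ) ⟨p, mem_connectedComponentIn hpZ, hp⟩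
    ⟨q, he ▸ mem_connectedComponentIn hqZ, hq⟩
  exact disjoint_left.1 hd hr.1 hr.2

namespace Attraction

variable {D : Attraction} {R : Set (ℝ × ℝ)} {Z : Set Config}

/-- By genericity `gx` and `gy` have no common zero on `{g = 0}`, so this set is locally a graph
over one of the axes. -/
theorem locally_path_connected_zeros (hZ : ∀ x y, toTorus (x, y) ∈ Z ↔ D.g x y = 0) :
    ∀ p ∈ Z, ∀ ε > 0, ∀ᶠ q in 𝓝 p, q ∈ Z → ∃ w : Path p q, (∀ t, w t ∈ Z) ∧
      ∃ l : C(unitInterval, ℝ), (∀ t, (l t : UnitAddCircle) = (w t).1) ∧ |l 1 - l 0| < ε := by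
  intro p hp ε hε
  obtain ⟨x₀, y₀, -, -, rfl⟩ := exists_toTorus p
  have h0 := (hZ _ _).1 hp
  obtain ⟨δ, hδ, H⟩ : ∃ δ > 0, ∀ x y, |x - x₀| < δ → |y - y₀| < δ → D.g x y = 0 →
      ∃ w : Path (x₀, y₀) (x, y), ∀ t, D.g (w t).1 (w t).2 = 0 ∧ |(w t).1 - x₀| < ε := by
    by_cases hy : D.gy x₀ y₀ = 0
    · obtain ⟨δ, hδ, H⟩ := exists_zero_path (f := fun y x => D.g x y) (fy := fun y x => D.gx x y)
        (D.cont.comp continuous_swap) (D.cont_x.comp continuous_swap) (fun y x => D.deriv_x x y)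
        h0 (D.generic _ _ h0 hy).1 hε
      refine ⟨δ, hδ, fun x y hx hy hg => ?_⟩
      obtain ⟨w, hw⟩ := H y x hy hx hg
      exact ⟨w.map continuous_swap, fun t => ⟨(hw t).1, (hw t).2.2⟩⟩
    · obtain ⟨δ, hδ, H⟩ := exists_zero_path D.cont D.cont_y D.deriv_y h0 hy hε
      refine ⟨δ, hδ, fun x y hx hy hg => ?_⟩
      obtain ⟨w, hw⟩ := H x y hx hy hg
      exact ⟨w, fun t => ⟨(hw t).1, (hw t).2.1⟩⟩
  filter_upwards [isOpenMap_toTorus.image_mem_nhds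
    ((eventually_abs_fst (x₀, y₀) hδ).and (eventually_abs_snd (x₀, y₀) hδ))] with q hq hqZ
  obtain ⟨⟨x, y⟩, ⟨hx, hy⟩, rfl⟩ := hq
  obtain ⟨w, hw⟩ := H x y hx hy ((hZ _ _).1 hqZ)
  refine ⟨w.map continuous_toTorus, fun t => (hZ _ _).2 (hw t).1,
    ⟨fun t => (w t).1, by fun_prop⟩, fun t => rfl, ?_⟩
  have := (hw 1).2
  simpa using this

/-- A separation of the strip inside the zero set produces an essential component. -/
theorem exists_essential (hZ : ∀ x y, toTorus (x, y) ∈ Z ↔ D.g x y = 0) {Y P Q : Set (ℝ × ℝ)}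
    (hYc : IsClosed Y) (hYp : ∀ x y, (x + 1, y + 1) ∈ Y ↔ (x, y) ∈ Y)
    (hYs : ∀ x y, (x, y) ∈ Y → x < y ∧ y < x + 1) (hY0 : ∀ x y, (x, y) ∈ Y → D.g x y = 0)
    (hP : IsClosed P) (hQ : IsClosed Q) (hPp : ∀ x y, (x + 1, y + 1) ∈ P ↔ (x, y) ∈ P)
    (hcov : ∀ x y, x ≤ y → y ≤ x + 1 → (x, y) ∈ P ∨ (x, y) ∈ Q)
    (hPQ : ∀ x y, x ≤ y → y ≤ x + 1 → (x, y) ∈ P → (x, y) ∈ Q → (x, y) ∈ Y)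
    (hbot : ∀ x, (x, x) ∈ P) (htop : ∀ x, (x, x + 1) ∈ Q) :
    ∃ p ∈ toTorus '' Y, p ∈ Z ∧ ¬ IsContractible (connectedComponentIn Z p) := by
  by_contra! hcon
  have hKZ : toTorus '' Y ⊆ Z := by
    rintro _ ⟨⟨x, y⟩, h, rfl⟩
    exact (hZ x y).2 (hY0 x y h)
  obtain ⟨φ, hφ⟩ := exists_lift_of_contractible (isClosed_image_toTorus hYc hYp hYs) hKZ
    (locally_path_connected_zeros hZ) fun p hp => hcon p hp (hKZ hp)
  -- On `Y` both `φ` and `x` lift the same angle, so their difference is an integer; it drops by `1`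
  -- under the shift because `φ` is defined on the torus.
  refine strip_separation hP hQ hPp (ψ := fun z => φ (toTorus z) - z.1)
    ((φ.continuous.comp continuous_toTorus).sub continuous_fst) (fun x y => ?_) hcov
    (fun x y h1 h2 hxP hxQ => ?_) hbot htop
  · have := toTorus_add_int x y 1 1
    simp only [Int.cast_one] at this
    rw [this]
    ring
  · have := hφ _ ⟨_, hPQ x y h1 h2 hxP hxQ, rfl⟩
    exact coe_eq_coe_iff_exists_int.1 this.symm

/-- The part of `{g ≤ 0}` below a set `R`. -/
def lowerPart (D : Attraction) (R : Set (ℝ × ℝ)) : Set (ℝ × ℝ) :=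
  flip ⁻¹' D.reflect.upperPart (flip ⁻¹' R)

theorem reflect_g_flip (z : ℝ × ℝ) : D.reflect.g (flip z).1 (flip z).2 = -D.g z.1 z.2 := by
  change -D.g (- -z.1) (1 - (1 - z.2)) = _
  rw [neg_neg, sub_sub_cancel]

theorem isClosed_lowerPart : IsClosed (D.lowerPart R) :=
  isClosed_upperPart.preimage flip.continuous

theorem nonpos_of_mem_lowerPart {z : ℝ × ℝ} (h : z ∈ D.lowerPart R) : D.g z.1 z.2 ≤ 0 := by
  have := nonneg_of_mem_upperPart h
  rw [reflect_g_flip] at this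
  linarith

theorem mem_lowerPart {z : ℝ × ℝ} (h : D.g z.1 z.2 ≤ 0) {y : ℝ} (hy : z.2 ≤ y)
    (hz : (z.1, y) ∈ R) : z ∈ D.lowerPart R := by
  refine mem_upperPart (y := 1 - y) ?_ (sub_le_sub_left hy 1) ?_
  · rw [reflect_g_flip]
    linarith
  · change (- -z.1, 1 - (1 - y)) ∈ R
    rwa [neg_neg, sub_sub_cancel]

theorem lowerPart_margin {ε : ℝ} (hε : ∀ z ∈ R, z.1 + ε ≤ z.2 ∧ z.2 ≤ z.1 + 1 - ε) {z : ℝ × ℝ}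
    (h : z ∈ D.lowerPart R) : z.2 ≤ z.1 + 1 - ε := by
  have : -z.1 + ε ≤ 1 - z.2 := upperPart_margin (R := flip ⁻¹' R) (fun w hw => by
    have : -w.1 + ε ≤ 1 - w.2 ∧ 1 - w.2 ≤ -w.1 + 1 - ε := hε _ hw
    constructor <;> linarith) h
  linarith

theorem IsTrap.lowerPart_periodic (hR : D.IsTrap R) (x y : ℝ) :
    (x + 1, y + 1) ∈ D.lowerPart R ↔ (x, y) ∈ D.lowerPart R := by
  have := hR.reflect.upperPart_periodic (-x - 1) (-y)
  rw [lowerPart, mem_preimage, mem_preimage, flip_mk, flip_mk]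
  rw [show -(x + 1) = -x - 1 by ring, show 1 - (y + 1) = -y by ring, ← this]
  ring_nf

theorem IsTrap.isClosed_diff_lowerPart (hR : D.IsTrap R) :
    IsClosed ({z | D.g z.1 z.2 ≤ 0} \ D.lowerPart R) := by
  convert hR.reflect.isClosed_diff_upperPart.preimage flip.continuous using 1
  ext z
  simp only [Set.mem_sdiff, mem_preimage, mem_ofPred_eq, reflect_g_flip, lowerPart, neg_nonneg]

/-- A trap gives rise to three essential components of the zero set on the torus. -/
theorem IsTrap.exists_three (hR : D.IsTrap R) (hZ : ∀ x y, toTorus (x, y) ∈ Z ↔ D.g x y = 0) :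
    ∃ p ∈ Z, ∃ q ∈ Z, ∃ r ∈ Z, ¬ IsContractible (connectedComponentIn Z p) ∧
      ¬ IsContractible (connectedComponentIn Z q) ∧ ¬ IsContractible (connectedComponentIn Z r) ∧
      connectedComponentIn Z p ≠ connectedComponentIn Z q ∧
      connectedComponentIn Z p ≠ connectedComponentIn Z r ∧
      connectedComponentIn Z q ≠ connectedComponentIn Z r := by
  obtain ⟨ε, hε, hε2, H⟩ := D.exists_margin
  have hRm := hR.margin H
  set A := D.upperPart R with hA
  set B := D.lowerPart R with hB
  set G : Set (ℝ × ℝ) := {z | 0 ≤ D.g z.1 z.2} with hG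
  set N : Set (ℝ × ℝ) := {z | D.g z.1 z.2 ≤ 0} with hN
  set V : Set (ℝ × ℝ) := {z | z.1 + ε ≤ z.2} with hV
  set W : Set (ℝ × ℝ) := {z | z.2 ≤ z.1 + 1 - ε} with hW
  have cA : IsClosed A := isClosed_upperPart
  have cB : IsClosed B := isClosed_lowerPart
  have cGA : IsClosed (G \ A) := hR.isClosed_diff_upperPart
  have cNB : IsClosed (N \ B) := hR.isClosed_diff_lowerPart
  have cG : IsClosed G := isClosed_le continuous_const D.cont
  have cN : IsClosed N := isClosed_le D.cont continuous_const
  have cV : IsClosed V := isClosed_le (by fun_prop) (by fun_prop)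
  have cW : IsClosed W := isClosed_le (by fun_prop) (by fun_prop)
  have hper : ∀ x y, D.g (x + 1) (y + 1) = D.g x y := fun x y => by
    rw [D.periodic_x, D.periodic_y]
  have pA : ∀ x y, (x + 1, y + 1) ∈ A ↔ (x, y) ∈ A := hR.upperPart_periodic
  have pB : ∀ x y, (x + 1, y + 1) ∈ B ↔ (x, y) ∈ B := hR.lowerPart_periodic
  have pG : ∀ x y, (x + 1, y + 1) ∈ G ↔ (x, y) ∈ G := fun x y => by
    simp only [hG, mem_ofPred_eq, hper]
  have pN : ∀ x y, (x + 1, y + 1) ∈ N ↔ (x, y) ∈ N := fun x y => by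
    simp only [hN, mem_ofPred_eq, hper]
  have pV : ∀ x y, (x + 1, y + 1) ∈ V ↔ (x, y) ∈ V := fun x y => by
    simp only [hV, mem_ofPred_eq]; constructor <;> intro h <;> linarith
  have pW : ∀ x y, (x + 1, y + 1) ∈ W ↔ (x, y) ∈ W := fun x y => by
    simp only [hW, mem_ofPred_eq]; constructor <;> intro h <;> linarith
  have AG : A ⊆ G := fun z hz => nonneg_of_mem_upperPart hz
  have BN : B ⊆ N := fun z hz => nonpos_of_mem_lowerPart hz
  have AV : A ⊆ V := fun z hz => upperPart_margin hRm hz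
  have BW : B ⊆ W := fun z hz => lowerPart_margin hRm hz
  have GN : ∀ z, z ∈ G ∨ z ∈ N := fun z => le_total 0 (D.g z.1 z.2)
  have GN0 : ∀ {z : ℝ × ℝ}, z ∈ G → z ∈ N → D.g z.1 z.2 = 0 := fun h1 h2 => le_antisymm h2 h1
  -- Here the trap has to meet every vertical line: the point of `R` on the line through `z` lies
  -- below or above `z`.
  have AB : ∀ z, z ∈ G → z ∈ N → z ∈ A ∨ z ∈ B := fun z h1 h2 => by
    obtain ⟨y, hy⟩ := hR.exists_mem z.1
    rcases le_total y z.2 with h | h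
    · exact .inl (mem_upperPart h1 h hy)
    · exact .inr (mem_lowerPart h2 h hy)
  have botG : ∀ x, (x, x) ∈ G := fun x => (D.diag x).ge
  have botN : ∀ x, (x, x) ∈ N := fun x => (D.diag x).le
  have topG : ∀ x, (x, x + 1) ∈ G := fun x => by
    change 0 ≤ D.g x (x + 1)
    rw [D.periodic_y, D.diag]
  have topN : ∀ x, (x, x + 1) ∈ N := fun x => by
    change D.g x (x + 1) ≤ 0
    rw [D.periodic_y, D.diag]
  have botV : ∀ x, (x, x) ∉ V := fun x h => by
    have : x + ε ≤ x := h
    linarith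
  have topW : ∀ x, (x, x + 1) ∉ W := fun x h => by
    have : x + 1 ≤ x + 1 - ε := h
    linarith
  have topA : ∀ x, (x, x + 1) ∈ A := fun x =>
    (AB _ (topG x) (topN x)).resolve_right fun h => topW x (BW h)
  have botB : ∀ x, (x, x) ∈ B := fun x =>
    (AB _ (botG x) (botN x)).resolve_left fun h => botV x (AV h)
  have lowG : ∀ x y, x ≤ y → (x, y) ∉ V → (x, y) ∈ G \ A := fun x y hxy hv => by
    refine ⟨?_, fun h => hv (AV h)⟩
    rcases hxy.eq_or_lt with rfl | hlt
    · exact botG x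
    · have hv' : ¬ x + ε ≤ y := hv
      have := (H x (y - x) (by linarith) (by linarith)).1
      rw [add_sub_cancel] at this
      exact this.le
  have highN : ∀ x y, y ≤ x + 1 → (x, y) ∉ W → (x, y) ∈ N \ B := fun x y hxy hw => by
    refine ⟨?_, fun h => hw (BW h)⟩
    rcases hxy.eq_or_lt with rfl | hlt
    · exact topN x
    · have hw' : ¬ y ≤ x + 1 - ε := hw
      have := (H x (x + 1 - y) (by linarith) (by linarith)).2
      rw [← D.periodic_y, show x - (x + 1 - y) + 1 = y by ring] at this
      exact this.le
  have zVW : ∀ x y, x < y → y < x + 1 → D.g x y = 0 → (x, y) ∈ V ∧ (x, y) ∈ W := fun x y h1 h2 h3 =>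
    zero_margin H h1 h2 h3
  have hstrip : ∀ {x y : ℝ}, (x, y) ∈ V → (x, y) ∈ W → x < y ∧ y < x + 1 := fun {x y} h1 h2 => by
    have h1 : x + ε ≤ y := h1
    have h2 : y ≤ x + 1 - ε := h2
    constructor <;> linarith
  -- Schematically the strip consists, from bottom to top, of `G \ A`, `B`, `A` and `N \ B`; the
  -- three sets are the interfaces. `V ∩ W` removes the boundary lines, which also consist of zeros;
  -- for `A ∩ B` this is automatic.
  set Y₁ := (G \ A) ∩ N ∩ (V ∩ W) with hY₁
  set Y₂ := A ∩ B with hY₂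
  set Y₃ := (N \ B) ∩ G ∩ (V ∩ W) with hY₃
  have cY₁ : IsClosed Y₁ := (cGA.inter cN).inter (cV.inter cW)
  have cY₂ : IsClosed Y₂ := cA.inter cB
  have cY₃ : IsClosed Y₃ := (cNB.inter cG).inter (cV.inter cW)
  have pY₁ : ∀ x y, (x + 1, y + 1) ∈ Y₁ ↔ (x, y) ∈ Y₁ := fun x y => by
    simp only [hY₁, mem_inter_iff, Set.mem_sdiff, pA, pG, pN, pV, pW]
  have pY₂ : ∀ x y, (x + 1, y + 1) ∈ Y₂ ↔ (x, y) ∈ Y₂ := fun x y => by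
    simp only [hY₂, mem_inter_iff, pA, pB]
  have pY₃ : ∀ x y, (x + 1, y + 1) ∈ Y₃ ↔ (x, y) ∈ Y₃ := fun x y => by
    simp only [hY₃, mem_inter_iff, Set.mem_sdiff, pB, pG, pN, pV, pW]
  have sY₁ : ∀ x y, (x, y) ∈ Y₁ → x < y ∧ y < x + 1 := fun x y h => hstrip h.2.1 h.2.2
  have sY₂ : ∀ x y, (x, y) ∈ Y₂ → x < y ∧ y < x + 1 := fun x y h => hstrip (AV h.1) (BW h.2)
  have sY₃ : ∀ x y, (x, y) ∈ Y₃ → x < y ∧ y < x + 1 := fun x y h => hstrip h.2.1 h.2.2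
  -- the lower, the middle and the upper band each contain an essential component
  obtain ⟨p, hpY, hpZ, hp⟩ := exists_essential hZ cY₁ pY₁ sY₁ (fun x y h => GN0 h.1.1.1 h.1.2)
    cGA ((cA.union cN).inter cV) (fun x y => by simp only [Set.mem_sdiff, pA, pG])
    (fun x y h1 h2 => by
      by_cases hv : (x, y) ∈ V
      · by_cases ha : (x, y) ∈ A
        · exact .inr ⟨.inl ha, hv⟩
        · exact (GN (x, y)).imp (fun h => ⟨h, ha⟩) fun h => ⟨.inr h, hv⟩
      · exact .inl (lowG x y h1 hv))
    (fun x y h1 h2 hP hQ => by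
      have hn : (x, y) ∈ N := hQ.1.resolve_left hP.2
      refine ⟨⟨hP, hn⟩, hQ.2, ?_⟩
      rcases h2.eq_or_lt with rfl | h2'
      · exact absurd (topA x) hP.2
      · rcases h1.eq_or_lt with rfl | h1'
        · exact absurd hQ.2 (botV x)
        · exact (zVW x y h1' h2' (GN0 hP.1 hn)).2)
    (fun x => ⟨botG x, fun h => botV x (AV h)⟩)
    (fun x => ⟨.inl (topA x), AV (topA x)⟩)
  obtain ⟨q, hqY, hqZ, hq⟩ := exists_essential hZ cY₂ pY₂ sY₂ (fun x y h => GN0 (AG h.1) (BN h.2))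
    (cGA.union cB) (cA.union cNB) (fun x y => by simp only [mem_union, Set.mem_sdiff, pA, pG, pB])
    (fun x y _ _ => by
      by_cases ha : (x, y) ∈ A
      · exact .inr (.inl ha)
      · by_cases hb : (x, y) ∈ B
        · exact .inl (.inr hb)
        · exact (GN (x, y)).imp (fun h => .inl ⟨h, ha⟩) fun h => .inr ⟨h, hb⟩)
    (fun x y _ _ hP hQ => by
      rcases hP with hP | hP
      · rcases hQ with hQ | hQ
        · exact absurd hQ hP.2
        · exact ((AB _ hP.1 hQ.1).elim hP.2 hQ.2).elim
      · rcases hQ with hQ | hQ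
        · exact ⟨hQ, hP⟩
        · exact absurd hP hQ.2)
    (fun x => .inr (botB x)) (fun x => .inl (topA x))
  obtain ⟨r, hrY, hrZ, hr⟩ := exists_essential hZ cY₃ pY₃ sY₃ (fun x y h => GN0 h.1.2 h.1.1.1)
    ((cB.union cG).inter cW) cNB
    (fun x y => by simp only [mem_inter_iff, mem_union, pB, pG, pW])
    (fun x y h1 h2 => by
      by_cases hw : (x, y) ∈ W
      · by_cases hb : (x, y) ∈ B
        · exact .inl ⟨.inl hb, hw⟩
        · exact (GN (x, y)).imp (fun h => ⟨.inr h, hw⟩) fun h => ⟨h, hb⟩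
      · exact .inr (highN x y h2 hw))
    (fun x y h1 h2 hP hQ => by
      have hg : (x, y) ∈ G := hP.1.resolve_left hQ.2
      refine ⟨⟨hQ, hg⟩, ?_, hP.2⟩
      rcases h1.eq_or_lt with rfl | h1'
      · exact absurd (botB x) hQ.2
      · rcases h2.eq_or_lt with rfl | h2'
        · exact absurd hP.2 (topW x)
        · exact (zVW x y h1' h2' (GN0 hg hQ.1)).1)
    (fun x => ⟨.inl (botB x), BW (botB x)⟩)
    (fun x => ⟨topN x, fun h => topW x (BW h)⟩)
  -- The diagonal only completes the cover of `Z` by closed sets; its own component is not counted.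
  set Δ : Set Config := {p | p.1 = p.2} with hΔ
  have cΔ : IsClosed Δ := isClosed_eq continuous_fst continuous_snd
  have dΔ : ∀ {Y : Set (ℝ × ℝ)}, (∀ x y, (x, y) ∈ Y → x < y ∧ y < x + 1) →
      Disjoint (toTorus '' Y) Δ := fun hY => disjoint_image_toTorus_diag hY
  have dY : ∀ {Y Y' : Set (ℝ × ℝ)}, (∀ x y, (x, y) ∈ Y → x < y ∧ y < x + 1) →
      (∀ x y, (x, y) ∈ Y' → x < y ∧ y < x + 1) → (∀ x y, (x + 1, y + 1) ∈ Y' ↔ (x, y) ∈ Y') →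
      (∀ z ∈ Y, z ∉ Y') → Disjoint (toTorus '' Y) (toTorus '' Y') := by
    intro Y Y' h1 h2 h3 h4
    rw [disjoint_left]
    rintro _ ⟨⟨x, y⟩, h, rfl⟩ hd
    exact h4 _ h (mem_of_toTorus_mem h3 h2 (h1 x y h).1 (h1 x y h).2 hd)
  have d12 : Disjoint (toTorus '' Y₁) (toTorus '' Y₂) :=
    dY sY₁ sY₂ pY₂ fun z h h' => h.1.1.2 h'.1
  have d13 : Disjoint (toTorus '' Y₁) (toTorus '' Y₃) :=
    dY sY₁ sY₃ pY₃ fun z h h' => (AB z h.1.1.1 h.1.2).elim h.1.1.2 h'.1.1.2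
  have d23 : Disjoint (toTorus '' Y₂) (toTorus '' Y₃) :=
    dY sY₂ sY₃ pY₃ fun z h h' => h'.1.1.2 h.2
  have k1 := isClosed_image_toTorus cY₁ pY₁ sY₁
  have k2 := isClosed_image_toTorus cY₂ pY₂ sY₂
  have k3 := isClosed_image_toTorus cY₃ pY₃ sY₃
  have cover : ∀ p ∈ Z, p ∈ Δ ∨ p ∈ toTorus '' Y₁ ∨ p ∈ toTorus '' Y₂ ∨ p ∈ toTorus '' Y₃ := by
    intro p hp
    obtain ⟨x, y, h1, h2, rfl⟩ := exists_toTorus p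
    have h0 := (hZ x y).1 hp
    rcases h1.eq_or_lt with rfl | h1
    · exact .inl rfl
    · right
      obtain ⟨hv, hw⟩ := zVW x y h1 h2 h0
      have hg : (x, y) ∈ G := h0.ge
      have hn : (x, y) ∈ N := h0.le
      by_cases ha : (x, y) ∈ A
      · by_cases hb : (x, y) ∈ B
        · exact .inr (.inl ⟨_, ⟨ha, hb⟩, rfl⟩)
        · exact .inr (.inr ⟨_, ⟨⟨⟨hn, hb⟩, hg⟩, hv, hw⟩, rfl⟩)
      · exact .inl ⟨_, ⟨⟨⟨hg, ha⟩, hn⟩, hv, hw⟩, rfl⟩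
  have c1 : Z ⊆ toTorus '' Y₁ ∪ (Δ ∪ (toTorus '' Y₂ ∪ toTorus '' Y₃)) := fun p hp => by
    rcases cover p hp with h | h | h | h
    exacts [.inr (.inl h), .inl h, .inr (.inr (.inl h)), .inr (.inr (.inr h))]
  have c2 : Z ⊆ toTorus '' Y₂ ∪ (Δ ∪ (toTorus '' Y₁ ∪ toTorus '' Y₃)) := fun p hp => by
    rcases cover p hp with h | h | h | h
    exacts [.inr (.inl h), .inr (.inr (.inl h)), .inl h, .inr (.inr (.inr h))]
  have d1 : Disjoint (toTorus '' Y₁) (Δ ∪ (toTorus '' Y₂ ∪ toTorus '' Y₃)) :=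
    disjoint_union_right.2 ⟨dΔ sY₁, disjoint_union_right.2 ⟨d12, d13⟩⟩
  have d2 : Disjoint (toTorus '' Y₂) (Δ ∪ (toTorus '' Y₁ ∪ toTorus '' Y₃)) :=
    disjoint_union_right.2 ⟨dΔ sY₂, disjoint_union_right.2 ⟨d12.symm, d23⟩⟩
  exact ⟨p, hpZ, q, hqZ, r, hrZ, hp, hq, hr,
    connectedComponentIn_ne k1 (cΔ.union (k2.union k3)) d1 c1 hpZ hqZ hpY (.inr (.inl hqY)),
    connectedComponentIn_ne k1 (cΔ.union (k2.union k3)) d1 c1 hpZ hrZ hpY (.inr (.inr hrY)),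
    connectedComponentIn_ne k2 (cΔ.union (k1.union k3)) d2 c2 hqZ hrZ hqY (.inr (.inr hrY))⟩

end Attraction

end Puppy

namespace Puppy

open Set Filter Topology

/-! ### Runs along vertical lines -/

namespace Attraction

variable {D : Attraction}

/-- Points on the vertical line through the pivot lie on neither side of it, so `exists_side` leaves
only the pivot with `0 ≤ g`. -/
theorem Pivot.eventually_neg {x y : ℝ} (h : D.Pivot x y) (hf : D.gyy x y < 0) :
    ∀ᶠ t in 𝓝 y, t ≠ y → D.g x t < 0 := by
  obtain ⟨σ, -, h1, -⟩ := h.exists_side hf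
  have hc : Tendsto (fun t : ℝ => (x, t)) (𝓝 y) (𝓝 (x, y)) :=
    (by fun_prop : Continuous fun t : ℝ => (x, t)).tendsto y
  filter_upwards [hc.eventually h1] with t ht hne
  by_contra! h0
  rcases ht h0 with h | h
  · exact hne (Prod.ext_iff.1 h).2
  · simp at h

theorem reflect_g (x y : ℝ) : D.reflect.g (-x) (1 - y) = -D.g x y := reflect_g_flip (x, y)

theorem reflect_gy (x y : ℝ) : D.reflect.gy (-x) (1 - y) = D.gy x y := by
  change D.gy (- -x) (1 - (1 - y)) = _
  rw [neg_neg, sub_sub_cancel]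

theorem reflect_gyy (x y : ℝ) : D.reflect.gyy (-x) (1 - y) = -D.gyy x y := by
  change -D.gyy (- -x) (1 - (1 - y)) = _
  rw [neg_neg, sub_sub_cancel]

theorem reflect_stable {x y : ℝ} : D.reflect.Stable (-x) (1 - y) ↔ D.Stable x y := by
  rw [Stable, Stable, reflect_g, reflect_gy, neg_eq_zero]

theorem reflect_pivot {x y : ℝ} : D.reflect.Pivot (-x) (1 - y) ↔ D.Pivot x y := by
  rw [Pivot, Pivot, reflect_g, reflect_gy, neg_eq_zero]

theorem Pivot.eventually_pos {x y : ℝ} (h : D.Pivot x y) (hf : 0 < D.gyy x y) :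
    ∀ᶠ t in 𝓝 y, t ≠ y → 0 < D.g x t := by
  have h1 := (reflect_pivot.2 h).eventually_neg (by rw [reflect_gyy]; linarith)
  have hc : Tendsto (fun t : ℝ => 1 - t) (𝓝 y) (𝓝 (1 - y)) :=
    (by fun_prop : Continuous fun t : ℝ => 1 - t).tendsto y
  filter_upwards [hc.eventually h1] with t ht hne
  have := ht (by contrapose! hne; linarith)
  rw [reflect_g] at this
  linarith

theorem eventually_sign_of_neg {x y : ℝ} (h0 : D.g x y = 0) (h1 : D.gy x y < 0) :
    ∀ᶠ t in 𝓝 y, (t < y → 0 < D.g x t) ∧ (y < t → D.g x t < 0) := by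
  have hd : deriv (D.g x) y < 0 := by rwa [(D.deriv_y x y).deriv]
  filter_upwards [eventually_nhdsWithin_sign_eq_of_deriv_neg hd h0] with t ht
  constructor
  · intro hlt
    rw [sign_pos (sub_pos.2 hlt), sign_eq_one_iff] at ht
    exact ht
  · intro hlt
    rw [sign_neg (sub_neg.2 hlt), sign_eq_neg_one_iff] at ht
    exact ht

/-- The configurations through which the puppy runs forward. -/
def Running (D : Attraction) (x t : ℝ) : Prop := D.g x t < 0 ∨ D.Pivot x t ∧ D.gyy x t < 0

/-- These copies of the diagonal stop every forward run. -/
theorem stable_add_nat (x : ℝ) (n : ℕ) : D.Stable x (x + n) := by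
  induction n with
  | zero =>
    rw [Nat.cast_zero, add_zero]
    exact ⟨D.diag x, D.diag_pos x⟩
  | succ n ih =>
    have hper : ∀ y, D.gy x (y + 1) = D.gy x y := fun y => by
      have h := (D.deriv_y x (y + 1)).comp y ((hasDerivAt_id y).add_const 1)
      have h' : D.g x ∘ (fun y => id y + 1) = D.g x := funext fun y => D.periodic_y _ _
      rw [h', mul_one] at h
      exact h.unique (D.deriv_y x y)
    push_cast
    rw [← add_assoc]
    exact ⟨(D.periodic_y _ _).trans ih.1, by rw [hper]; exact ih.2⟩

/-- A forward run ends in a stable configuration. -/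
theorem exists_run {x y : ℝ} (h : ∀ᶠ t in 𝓝 y, y < t → D.g x t < 0) :
    ∃ w > y, D.Stable x w ∧ ∀ t ∈ Ioo y w, D.Running x t := by
  set S : Set ℝ := {t | y < t ∧ ¬ D.Running x t} with hS
  have hne : S.Nonempty := by
    obtain ⟨n, hn⟩ := exists_nat_gt (y - x)
    refine ⟨x + n, by linarith, fun hr => ?_⟩
    have := D.stable_add_nat x n
    rcases hr with hr | hr
    · linarith [this.1]
    · linarith [hr.1.2, this.2]
  have hbd : BddBelow S := ⟨y, fun t ht => ht.1.le⟩
  set w := sInf S with hw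
  have hwS : w ∈ closure S := csInf_mem_closure hne hbd
  have hyw : y < w := by
    obtain ⟨δ, hδ, H⟩ := Metric.eventually_nhds_iff.1 h
    refine lt_of_lt_of_le (by linarith : y < y + δ) (le_csInf hne fun t ht => ?_)
    by_contra! hlt
    refine ht.2 (.inl (H ?_ ht.1))
    rw [Real.dist_eq, abs_lt]
    constructor <;> linarith [ht.1]
  have hrun : ∀ t ∈ Ioo y w, D.Running x t := fun t ht => by
    by_contra hnr
    exact not_lt.2 (csInf_le hbd ⟨ht.1, hnr⟩) ht.2
  have hnonpos : ∀ t ∈ Ioo y w, D.g x t ≤ 0 := fun t ht =>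
    (hrun t ht).elim le_of_lt fun h => h.1.1.le
  have notpos : ¬ ∀ᶠ t in 𝓝 w, t < w → 0 < D.g x t := fun hev => by
    have h1 : ∀ᶠ t in 𝓝[<] w, 0 < D.g x t := by
      filter_upwards [nhdsWithin_le_nhds hev, self_mem_nhdsWithin] with t ht ht' using ht ht'
    obtain ⟨t, ht, ht'⟩ := (h1.and (Ioo_mem_nhdsLT hyw)).exists
    exact not_lt.2 (hnonpos t ht') ht
  have notrun : ¬ ∀ᶠ t in 𝓝 w, D.Running x t := fun hev => by
    obtain ⟨t, ht, ht'⟩ := mem_closure_iff_nhds.1 hwS _ hev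
    exact ht'.2 ht
  have hc : ContinuousAt (D.g x) w := (D.deriv_y x w).continuousAt
  refine ⟨w, hyw, ?_, hrun⟩
  -- Running points `(x, w)` have only running neighbours on the line, against `w ∈ closure S`; the
  -- other non-stable types force `0 < g` just below `w`, where the puppy is still running forward.
  rcases lt_trichotomy (D.g x w) 0 with h0 | h0 | h0
  · exact absurd ((hc.eventually (gt_mem_nhds h0)).mono fun t ht => .inl ht) notrun
  · rcases lt_trichotomy (D.gy x w) 0 with h1 | h1 | h1
    · exact absurd ((eventually_sign_of_neg h0 h1).mono fun t ht => ht.1) notpos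
    · have hp : D.Pivot x w := ⟨h0, h1⟩
      rcases lt_or_gt_of_ne (D.generic x w h0 h1).2 with h2 | h2
      · refine absurd ((hp.eventually_neg h2).mono fun t ht => ?_) notrun
        by_cases htw : t = w
        · exact htw ▸ .inr ⟨hp, h2⟩
        · exact .inl (ht htw)
      · exact (notpos ((hp.eventually_pos h2).mono fun t ht hlt => ht hlt.ne)).elim
    · exact ⟨h0, h1⟩
  · exact (notpos ((hc.eventually (lt_mem_nhds h0)).mono fun t ht _ => ht)).elim

theorem exists_forward_run {x y : ℝ} (h : D.g x y < 0 ∨ (D.g x y = 0 ∧ D.gy x y < 0) ∨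
    (D.Pivot x y ∧ D.gyy x y < 0)) :
    ∃ s > 0, D.Stable x (y + s) ∧
      ∀ t ∈ Ioo 0 s, D.g x (y + t) < 0 ∨ D.Pivot x (y + t) ∧ D.gyy x (y + t) < 0 := by
  have hev : ∀ᶠ t in 𝓝 y, y < t → D.g x t < 0 := by
    rcases h with h | h | h
    · exact ((D.deriv_y x y).continuousAt.eventually (gt_mem_nhds h)).mono fun t ht _ => ht
    · exact (eventually_sign_of_neg h.1 h.2).mono fun t ht => ht.2
    · exact (h.1.eventually_neg h.2).mono fun t ht hlt => ht hlt.ne'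
  obtain ⟨w, hw, hst, H⟩ := exists_run hev
  refine ⟨w - y, sub_pos.2 hw, by rwa [add_sub_cancel], fun t ht => H _ ⟨?_, ?_⟩⟩
  · linarith [ht.1]
  · linarith [ht.2]

theorem exists_backward_run {x y : ℝ} (h : 0 < D.g x y ∨ (D.g x y = 0 ∧ D.gy x y < 0) ∨
    (D.Pivot x y ∧ 0 < D.gyy x y)) :
    ∃ s > 0, D.Stable x (y - s) ∧
      ∀ t ∈ Ioo 0 s, 0 < D.g x (y - t) ∨ D.Pivot x (y - t) ∧ 0 < D.gyy x (y - t) := by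
  obtain ⟨s, hs, hst, H⟩ := D.reflect.exists_forward_run (x := -x) (y := 1 - y) (by
    rw [reflect_g, reflect_gy, reflect_pivot, reflect_gyy, neg_lt_zero, neg_lt_zero, neg_eq_zero]
    exact h)
  have e : ∀ t, 1 - y + t = 1 - (y - t) := fun t => by ring
  refine ⟨s, hs, ?_, fun t ht => ?_⟩
  · rwa [e, reflect_stable] at hst
  · have := H t ht
    rwa [e, reflect_g, reflect_pivot, reflect_gyy, neg_lt_zero, neg_lt_zero] at this

end Attraction

/-! ### The attraction field of a generic track -/

theorem velocity_coe (γ : UnitAddCircle → Plane) (x : ℝ) :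
    velocity γ x = deriv (fun t : ℝ => γ (t : UnitAddCircle)) x := by
  have := deriv_comp_const_add (fun t : ℝ => γ (t : UnitAddCircle)) x 0
  rw [add_zero] at this
  rw [← this]
  rfl

theorem partialY_toTorus (γ : UnitAddCircle → Plane) (k : ℕ) (x y : ℝ) :
    partialY γ k (toTorus (x, y)) =
      iteratedDeriv k (fun t : ℝ => dist (γ (x : UnitAddCircle)) (γ (t : UnitAddCircle)) ^ 2) y := by
  have := congrFun (iteratedDeriv_comp_const_add k
    (fun t : ℝ => dist (γ (x : UnitAddCircle)) (γ (t : UnitAddCircle)) ^ 2) y) 0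
  rw [add_zero] at this
  rw [← this]
  rfl

/-- Both genericity conditions enter through the field `generic`: `transverse` gives `gx ≠ 0`, since
`gx` is `-2` times the inner product of the velocities, and `exhaustive` gives `gyy ≠ 0`. Regularity
gives `diag_pos`. -/
theorem IsGenericTrack.exists_attraction {γ : UnitAddCircle → Plane} (hγ : IsGenericTrack γ) :
    ∃ D : Attraction, ∀ x y, partialY γ 1 (toTorus (x, y)) = D.g x y ∧
      partialY γ 2 (toTorus (x, y)) = D.gy x y ∧ partialY γ 3 (toTorus (x, y)) = D.gyy x y := by
  set c : ℝ → Plane := fun t => γ (t : UnitAddCircle) with hc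
  have s3 : ContDiff ℝ (3 : ℕ) c := hγ.contDiff
  have s2 : ContDiff ℝ (2 : ℕ) (deriv c) := ContDiff.iterate_deriv' 2 1 s3
  have s1 : ContDiff ℝ (1 : ℕ) (deriv (deriv c)) := ContDiff.iterate_deriv' 1 1 s2
  have s0 : ContDiff ℝ (0 : ℕ) (deriv (deriv (deriv c))) := ContDiff.iterate_deriv' 0 1 s1
  set c₁ := deriv c with hc₁
  set c₂ := deriv c₁ with hc₂
  set c₃ := deriv c₂ with hc₃
  have d0 : ∀ t, HasDerivAt c (c₁ t) t := fun t =>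
    (s3.differentiable (by norm_num) t).hasDerivAt
  have d1 : ∀ t, HasDerivAt c₁ (c₂ t) t := fun t =>
    (s2.differentiable (by norm_num) t).hasDerivAt
  have d2 : ∀ t, HasDerivAt c₂ (c₃ t) t := fun t =>
    (s1.differentiable (by norm_num) t).hasDerivAt
  have k0 : Continuous c := s3.continuous
  have k1 : Continuous c₁ := s2.continuous
  have k2 : Continuous c₂ := s1.continuous
  have k3 : Continuous c₃ := s0.continuous
  let g : ℝ → ℝ → ℝ := fun x y => 2 * inner ℝ (c y - c x) (c₁ y)
  let gx : ℝ → ℝ → ℝ := fun x y => -2 * inner ℝ (c₁ x) (c₁ y)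
  let gy : ℝ → ℝ → ℝ := fun x y => 2 * (inner ℝ (c y - c x) (c₂ y) + inner ℝ (c₁ y) (c₁ y))
  let gyy : ℝ → ℝ → ℝ := fun x y => 2 * (inner ℝ (c y - c x) (c₃ y) + 3 * inner ℝ (c₁ y) (c₂ y))
  have hE : ∀ x y, HasDerivAt (fun t => dist (c x) (c t) ^ 2) (g x y) y := fun x y => by
    have h := ((d0 y).sub_const (c x)).inner ℝ ((d0 y).sub_const (c x))
    have e : (fun t => dist (c x) (c t) ^ 2) = fun t => inner ℝ (c t - c x) (c t - c x) := by
      funext t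
      rw [dist_comm, dist_eq_norm, real_inner_self_eq_norm_sq]
    rw [e]
    convert! h using 1
    simp only [g]
    rw [real_inner_comm (c y - c x) (c₁ y)]
    ring
  have hdx : ∀ x y, HasDerivAt (fun x => g x y) (gx x y) x := fun x y => by
    have h := (((d0 x).const_sub (c y)).inner ℝ (hasDerivAt_const x (c₁ y))).const_mul 2
    convert! h using 1
    simp [gx]
  have hdy : ∀ x y, HasDerivAt (g x) (gy x y) y := fun x y => by
    have h := (((d0 y).sub_const (c x)).inner ℝ (d1 y)).const_mul 2
    exact h
  have hdyy : ∀ x y, HasDerivAt (gy x) (gyy x y) y := fun x y => by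
    have h := ((((d0 y).sub_const (c x)).inner ℝ (d2 y)).add ((d1 y).inner ℝ (d1 y))).const_mul 2
    convert! h using 1
    simp only [gyy]
    rw [real_inner_comm (c₁ y) (c₂ y)]
    ring
  have p1 : ∀ x y, partialY γ 1 (toTorus (x, y)) = g x y := fun x y => by
    rw [partialY_toTorus, iteratedDeriv_one]
    exact (hE x y).deriv
  have e1 : ∀ x, deriv (fun t => dist (c x) (c t) ^ 2) = g x := fun x => funext fun y =>
    (hE x y).deriv
  have e2 : ∀ x, deriv (g x) = gy x := fun x => funext fun y => (hdy x y).deriv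
  have e3 : ∀ x, deriv (gy x) = gyy x := fun x => funext fun y => (hdyy x y).deriv
  have p2 : ∀ x y, partialY γ 2 (toTorus (x, y)) = gy x y := fun x y => by
    rw [partialY_toTorus, iteratedDeriv_succ', iteratedDeriv_one]
    exact (congrArg (fun f => deriv f y) (e1 x)).trans (congrFun (e2 x) y)
  have p3 : ∀ x y, partialY γ 3 (toTorus (x, y)) = gyy x y := fun x y => by
    rw [partialY_toTorus, iteratedDeriv_succ', iteratedDeriv_succ', iteratedDeriv_one]
    refine (congrArg (fun f => deriv (deriv f) y) (e1 x)).trans ?_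
    rw [e2, e3]
  refine ⟨{ g := g, gx := gx, gy := gy, gyy := gyy
            cont := by simp only [g]; fun_prop
            cont_x := by simp only [gx]; fun_prop
            cont_y := by simp only [gy]; fun_prop
            cont_yy := by simp only [gyy]; fun_prop
            deriv_x := hdx
            deriv_y := hdy
            deriv_yy := hdyy
            periodic_x := fun x y => ?_
            periodic_y := fun x y => ?_
            diag := fun x => by simp [g]
            diag_pos := fun x => ?_
            generic := fun x y h0 h1 => ?_ }, fun x y => ⟨p1 x y, p2 x y, p3 x y⟩⟩
  · have := toTorus_add_int x y 1 0
    rw [← p1, ← p1, ← this]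
    simp
  · have := toTorus_add_int x y 0 1
    rw [← p1, ← p1, ← this]
    simp
  · have hne : c₁ x ≠ 0 := by
      rw [hc₁, ← velocity_coe]
      exact hγ.regular _
    simp only [gy, sub_self, inner_zero_left, zero_add]
    have := real_inner_self_pos.2 hne
    linarith
  · have hcr : IsCritical γ (toTorus (x, y)) := (p1 x y).trans h0
    have hpiv : IsPivot γ (toTorus (x, y)) := by
      rcases hγ.exhaustive _ hcr with h | h | h
      · exact absurd ((p2 x y).trans h1) h.2.ne'
      · exact absurd ((p2 x y).trans h1) h.2.ne
      · exact h
    constructor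
    · have := hγ.transverse _ hpiv
      change inner ℝ (velocity γ (x : UnitAddCircle)) (velocity γ (y : UnitAddCircle)) ≠ 0 at this
      rw [velocity_coe, velocity_coe] at this
      exact mul_ne_zero (by norm_num) this
    · rw [← p3]
      rcases hpiv with h | h
      · exact h.2.2.ne
      · exact h.2.2.ne'

end Puppy

namespace Puppy

open Set Filter Topology

/-! ### The game -/

/-- `D` is the lift to the plane of the attraction diagram of `γ`. -/
def Lifts (γ : UnitAddCircle → Plane) (D : Attraction) : Prop :=
  ∀ x y, partialY γ 1 (toTorus (x, y)) = D.g x y ∧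
    partialY γ 2 (toTorus (x, y)) = D.gy x y ∧ partialY γ 3 (toTorus (x, y)) = D.gyy x y

variable {γ : UnitAddCircle → Plane} {D : Attraction}

namespace Lifts

theorem critical_iff (h : Lifts γ D) {x y : ℝ} :
    IsCritical γ (toTorus (x, y)) ↔ D.g x y = 0 := by
  rw [IsCritical, (h x y).1]

theorem stable_iff (h : Lifts γ D) {x y : ℝ} :
    IsStable γ (toTorus (x, y)) ↔ D.Stable x y := by
  rw [IsStable, h.critical_iff, (h x y).2.1, Attraction.Stable]

theorem forward_iff (h : Lifts γ D) {x y : ℝ} :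
    (IsForward γ (toTorus (x, y)) ∨ IsForwardPivot γ (toTorus (x, y))) ↔
      (D.g x y < 0 ∨ D.Pivot x y ∧ D.gyy x y < 0) := by
  rw [IsForward, IsForwardPivot, h.critical_iff, (h x y).1, (h x y).2.1, (h x y).2.2,
    Attraction.Pivot, and_assoc]

theorem backward_iff (h : Lifts γ D) {x y : ℝ} :
    (IsBackward γ (toTorus (x, y)) ∨ IsBackwardPivot γ (toTorus (x, y))) ↔
      (0 < D.g x y ∨ D.Pivot x y ∧ 0 < D.gyy x y) := by
  rw [IsBackward, IsBackwardPivot, h.critical_iff, (h x y).1, (h x y).2.1, (h x y).2.2,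
    Attraction.Pivot, and_assoc]

theorem pivot (h : Lifts γ D) {x y : ℝ} (hp : D.Pivot x y) : IsPivot γ (toTorus (x, y)) := by
  rw [IsPivot, IsForwardPivot, IsBackwardPivot, h.critical_iff, (h x y).2.1, (h x y).2.2]
  exact (lt_or_gt_of_ne (D.generic x y hp.1 hp.2).2).imp (fun h => ⟨hp.1, hp.2, h⟩)
    fun h => ⟨hp.1, hp.2, h⟩

theorem forwardRun_iff (h : Lifts γ D) {x y : ℝ} {q : Config} :
    ForwardRun γ (toTorus (x, y)) q ↔ ∃ s > 0, q = toTorus (x, y + s) ∧ D.Stable x (y + s) ∧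
      ∀ t ∈ Ioo 0 s, D.g x (y + t) < 0 ∨ D.Pivot x (y + t) ∧ D.gyy x (y + t) < 0 := by
  have e : ∀ t : ℝ, ((toTorus (x, y)).1, (toTorus (x, y)).2 + (t : UnitAddCircle)) =
      toTorus (x, y + t) := fun t => by simp [toTorus]
  simp only [ForwardRun, e, h.forward_iff]
  refine exists_congr fun s => and_congr_right fun _ => and_congr_right fun hq => ?_
  rw [hq, h.stable_iff]

theorem backwardRun_iff (h : Lifts γ D) {x y : ℝ} {q : Config} :
    BackwardRun γ (toTorus (x, y)) q ↔ ∃ s > 0, q = toTorus (x, y - s) ∧ D.Stable x (y - s) ∧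
      ∀ t ∈ Ioo 0 s, 0 < D.g x (y - t) ∨ D.Pivot x (y - t) ∧ 0 < D.gyy x (y - t) := by
  have e : ∀ t : ℝ, ((toTorus (x, y)).1, (toTorus (x, y)).2 - (t : UnitAddCircle)) =
      toTorus (x, y - t) := fun t => by simp [toTorus]
  simp only [BackwardRun, e, h.backward_iff]
  refine exists_congr fun s => and_congr_right fun _ => and_congr_right fun hq => ?_
  rw [hq, h.stable_iff]

theorem exists_run (h : Lifts γ D) {p : Config} (hp : ¬ IsStable γ p) : ∃ q, Run γ p q := by
  obtain ⟨x, y, -, -, rfl⟩ := exists_toTorus p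
  rw [h.stable_iff] at hp
  have fwd : (D.g x y < 0 ∨ (D.g x y = 0 ∧ D.gy x y < 0) ∨ (D.Pivot x y ∧ D.gyy x y < 0)) →
      ∃ q, Run γ (toTorus (x, y)) q := fun hf => by
    obtain ⟨s, hs, h1, h2⟩ := Attraction.exists_forward_run hf
    exact ⟨_, .inl (h.forwardRun_iff.2 ⟨s, hs, rfl, h1, h2⟩)⟩
  have bwd : (0 < D.g x y ∨ (D.g x y = 0 ∧ D.gy x y < 0) ∨ (D.Pivot x y ∧ 0 < D.gyy x y)) →
      ∃ q, Run γ (toTorus (x, y)) q := fun hf => by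
    obtain ⟨s, hs, h1, h2⟩ := Attraction.exists_backward_run hf
    exact ⟨_, .inr (h.backwardRun_iff.2 ⟨s, hs, rfl, h1, h2⟩)⟩
  rcases lt_trichotomy (D.g x y) 0 with h0 | h0 | h0
  · exact fwd (.inl h0)
  · rcases lt_trichotomy (D.gy x y) 0 with h1 | h1 | h1
    · exact fwd (.inr (.inl ⟨h0, h1⟩))
    · rcases lt_or_gt_of_ne (D.generic x y h0 h1).2 with h2 | h2
      · exact fwd (.inr (.inr ⟨⟨h0, h1⟩, h2⟩))
      · exact bwd (.inr (.inr ⟨⟨h0, h1⟩, h2⟩))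
    · exact absurd ⟨h0, h1⟩ hp
  · exact bwd (.inl h0)

end Lifts

theorem CanCatch.of_diag {p : Config} (h : p.1 = p.2) : CanCatch γ p := by
  obtain ⟨x, y⟩ := p
  obtain rfl : x = y := h
  exact .caught x

theorem Run.stable {p q : Config} (h : Run γ p q) : IsStable γ q := by
  rcases h with ⟨_, _, _, h, _⟩ | ⟨_, _, _, h, _⟩ <;> exact h

/-- The lifts to the open strip of the stable configurations from which the puppy can escape. -/
def escape (γ : UnitAddCircle → Plane) : Set (ℝ × ℝ) :=
  {z | (z.1 < z.2 ∧ z.2 < z.1 + 1) ∧ IsStable γ (toTorus z) ∧ ¬ CanCatch γ (toTorus z)}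

namespace Lifts

/-- A walk along a stable arc. -/
theorem walk (h : Lifts γ D) {c : ℝ → ℝ × ℝ} {a b : ℝ} (hc : ContinuousOn c (uIcc a b))
    (hst : ∀ t ∈ uIcc a b, t ≠ b → D.Stable (c t).1 (c t).2) (hab : a ≠ b)
    (hb : D.Stable (c b).1 (c b).2 ∨ D.Pivot (c b).1 (c b).2) :
    Walk γ (toTorus (c a)) (toTorus (c b)) := by
  obtain ⟨w, hw⟩ := exists_path_of_continuousOn (continuous_toTorus.comp_continuousOn hc)
  refine ⟨⟨w, fun t ht => ?_⟩, hb.imp h.stable_iff.2 h.pivot⟩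
  rw [hw]
  have h0 : (0 : ℝ) ≤ t := t.2.1
  have h1 : (t : ℝ) < 1 := ht
  refine h.stable_iff.2 (hst _ ?_ ?_)
  · rw [mem_uIcc]
    rcases le_total a b with h | h
    · left; constructor <;> nlinarith
    · right; constructor <;> nlinarith
  · intro he
    have : (1 - (t : ℝ)) * (b - a) = 0 := by linarith
    rcases mul_eq_zero.1 this with h | h
    · linarith
    · exact hab (by linarith)

/-- Arcs can be walked in both directions, so a stable point on the arc that can be caught would
rescue every other point of the arc. -/
theorem escape_of_arc (h : Lifts γ D) {x y : ℝ} (h1 : x < y) (h2 : y < x + 1) {J : Set ℝ}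
    (hJ : J.OrdConnected) {c : ℝ → ℝ × ℝ} (hc : ContinuousOn c J)
    (hst : ∀ t ∈ J, D.Stable (c t).1 (c t).2)
    (hev : ∀ᶠ z in 𝓝 (x, y), D.Stable z.1 z.2 → ∃ t ∈ J, c t = z)
    (hcl : (x, y) ∈ closure (escape γ)) :
    ∀ᶠ z in 𝓝 (x, y), D.Stable z.1 z.2 → z ∈ escape γ := by
  obtain ⟨z₀, hz₀, hzR⟩ := mem_closure_iff_nhds.1 hcl _ hev
  obtain ⟨a, ha, rfl⟩ := hz₀ (h.stable_iff.1 hzR.2.1)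
  have o1 : ∀ᶠ z : ℝ × ℝ in 𝓝 (x, y), z.1 < z.2 :=
    (isOpen_lt continuous_fst continuous_snd).mem_nhds h1
  have o2 : ∀ᶠ z : ℝ × ℝ in 𝓝 (x, y), z.2 < z.1 + 1 :=
    (isOpen_lt continuous_snd (continuous_fst.add continuous_const)).mem_nhds h2
  filter_upwards [hev, o1, o2] with z hz hz1 hz2 hzst
  refine ⟨⟨hz1, hz2⟩, h.stable_iff.2 hzst, fun hcatch => hzR.2.2 ?_⟩
  obtain ⟨b, hb, rfl⟩ := hz hzst
  rcases eq_or_ne a b with rfl | hab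
  · exact hcatch
  · have hsub := hJ.uIcc_subset ha hb
    exact .walk _ _ (h.walk (hc.mono hsub) (fun t ht _ => hst t (hsub ht)) hab (.inl hzst)) hcatch

/-- A walk may end at a pivot, so the stable branch ending there would inherit a catch from it. -/
theorem not_canCatch_pivot (h : Lifts γ D) {x y : ℝ} (hp : D.Pivot x y)
    (hcl : (x, y) ∈ closure (escape γ)) : ¬ CanCatch γ (toTorus (x, y)) := by
  obtain ⟨δ, hδ, c, hc, hc0, hst, hev⟩ := hp.exists_arc
  obtain ⟨z₀, hz₀, hzR⟩ := mem_closure_iff_nhds.1 hcl _ hev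
  obtain ⟨a, ha, rfl⟩ := hz₀ (h.stable_iff.1 hzR.2.1)
  intro hcatch
  have hu : uIcc a 0 = Icc 0 a := uIcc_of_ge ha.1.le
  have hw : Walk γ (toTorus (c a)) (toTorus (c 0)) := by
    refine h.walk (hc.mono ?_) (fun t ht ht0 => hst t ?_) ha.1.ne' (.inr (by rwa [hc0]))
    · rw [hu]
      exact fun t ht => ⟨ht.1, ht.2.trans_lt ha.2⟩
    · rw [hu] at ht
      exact ⟨lt_of_le_of_ne ht.1 (Ne.symm ht0), ht.2.trans_lt ha.2⟩
  rw [hc0] at hw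
  exact hzR.2.2 (.walk _ _ hw hcatch)

/-- The rule `run` demands that every outcome be good, so at a pivot without a catch some outcome is
bad. -/
theorem exists_escaping_run (h : Lifts γ D) {x y : ℝ} (hp : D.Pivot x y)
    (hcl : (x, y) ∈ closure (escape γ)) :
    ∃ q, Run γ (toTorus (x, y)) q ∧ ¬ CanCatch γ q := by
  by_contra! hcon
  refine h.not_canCatch_pivot hp hcl (.run _ (h.exists_run fun hst => ?_) hcon)
  exact (h.stable_iff.1 hst).2.ne' hp.2

/-- The field `near` reflects the human's choice of walks; `forward` and `backward` reflect the
escaping runs from pivots. The end of such a run stays in the strip: on the diagonal the puppy would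
be caught, and a run cannot pass through the stable diagonal. -/
theorem isTrap_escape (h : Lifts γ D) (hne : ∃ p, IsStable γ p ∧ ¬ CanCatch γ p) :
    D.IsTrap (escape γ) := by
  constructor
  · obtain ⟨p, hp, hc⟩ := hne
    obtain ⟨x, y, h1, h2, rfl⟩ := exists_toTorus p
    refine ⟨(x, y), ⟨lt_of_le_of_ne h1 ?_, h2⟩, hp, hc⟩
    intro (he : x = y)
    exact hc (.of_diag (congrArg _ he))
  · exact fun x y hz => hz.1
  · exact fun x y hz => h.stable_iff.1 hz.2.1
  · intro x y
    have := toTorus_add_int x y 1 1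
    simp only [Int.cast_one] at this
    change ((x + 1 < y + 1 ∧ y + 1 < x + 1 + 1) ∧ _ ∧ _) ↔ ((x < y ∧ y < x + 1) ∧ _ ∧ _)
    rw [this, add_lt_add_iff_right, add_lt_add_iff_right]
  · intro x y h1 h2 h3 hcl
    rcases h3 with h3 | h3
    · obtain ⟨δ, -, c, hc, -, hst, hev⟩ := h3.exists_arc
      exact h.escape_of_arc h1 h2 ordConnected_Ioo hc hst hev hcl
    · obtain ⟨δ, -, c, hc, -, hst, hev⟩ := h3.exists_arc
      exact h.escape_of_arc h1 h2 ordConnected_Ioo (hc.mono Ioo_subset_Ico_self) hst hev hcl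
  · intro x y h1 h2 hp hf hcl
    obtain ⟨q, hq, hqc⟩ := h.exists_escaping_run hp hcl
    rcases hq with hq | hq
    · obtain ⟨s, hs, rfl, hst, hbet⟩ := h.forwardRun_iff.1 hq
      refine ⟨y + s, by linarith, ⟨⟨by linarith, ?_⟩, h.stable_iff.2 hst, hqc⟩, fun t ht => ?_⟩
      · by_contra! hge
        change x + 1 ≤ y + s at hge
        rcases hge.eq_or_lt with he | hlt
        · refine hqc (.of_diag (coe_eq_coe_iff_exists_int.2 ⟨1, ?_⟩))
          simp only [← he]
          simp
        · have hd := D.stable_add_nat x 1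
          have := hbet (x + 1 - y) ⟨by linarith, by linarith⟩
          rw [add_sub_cancel] at this
          simp only [Nat.cast_one] at hd
          rcases this with h' | h'
          · linarith [hd.1]
          · linarith [hd.2, h'.1.2]
      · have := hbet (t - y) ⟨by linarith [ht.1], by linarith [ht.2]⟩
        rwa [add_sub_cancel] at this
    -- Since `g < 0` on both sides of a forward pivot, no backward run starts there.
    · exfalso
      obtain ⟨s, hs, rfl, hst, hbet⟩ := h.backwardRun_iff.1 hq
      have ev : ∀ᶠ t in 𝓝[<] y, D.g x t < 0 := by
        filter_upwards [nhdsWithin_le_nhds (hp.eventually_neg hf), self_mem_nhdsWithin]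
          with t ht ht' using ht (ne_of_lt ht')
      obtain ⟨t, ht, ht'⟩ := (ev.and (Ioo_mem_nhdsLT (by linarith : y - s < y))).exists
      have := hbet (y - t) ⟨by linarith [ht'.2], by linarith [ht'.1]⟩
      rw [sub_sub_cancel] at this
      rcases this with h' | h'
      · linarith
      · linarith [h'.1.1]
  · intro x y h1 h2 hp hf hcl
    obtain ⟨q, hq, hqc⟩ := h.exists_escaping_run hp hcl
    rcases hq with hq | hq
    · exfalso
      obtain ⟨s, hs, rfl, hst, hbet⟩ := h.forwardRun_iff.1 hq
      have ev : ∀ᶠ t in 𝓝[>] y, 0 < D.g x t := by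
        filter_upwards [nhdsWithin_le_nhds (hp.eventually_pos hf), self_mem_nhdsWithin]
          with t ht ht' using ht (ne_of_gt ht')
      obtain ⟨t, ht, ht'⟩ := (ev.and (Ioo_mem_nhdsGT (by linarith : y < y + s))).exists
      have := hbet (t - y) ⟨by linarith [ht'.1], by linarith [ht'.2]⟩
      rw [add_sub_cancel] at this
      rcases this with h' | h'
      · linarith
      · linarith [h'.1.1]
    · obtain ⟨s, hs, rfl, hst, hbet⟩ := h.backwardRun_iff.1 hq
      refine ⟨y - s, by linarith, ⟨⟨?_, by linarith⟩, h.stable_iff.2 hst, hqc⟩, fun t ht => ?_⟩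
      · by_contra! hge
        change y - s ≤ x at hge
        rcases hge.eq_or_lt with he | hlt
        · exact hqc (.of_diag (coe_eq_coe_iff_exists_int.2 ⟨0, by simp [he]⟩))
        · have := hbet (y - x) ⟨by linarith, by linarith⟩
          rw [sub_sub_cancel] at this
          rcases this with h' | h'
          · linarith [D.diag x]
          · linarith [D.diag_pos x, h'.1.2]
      · have := hbet (y - t) ⟨by linarith [ht.2], by linarith [ht.1]⟩
        rwa [sub_sub_cancel] at this

theorem canCatch (h : Lifts γ D) (hess : (essentialCycles γ).ncard = 2) (p : Config) :
    CanCatch γ p := by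
  have hst : ∀ p, IsStable γ p → CanCatch γ p := by
    by_contra! hcon
    obtain ⟨p, hp, q, hq, r, hr, ep, eq, er, npq, npr, nqr⟩ :=
      (h.isTrap_escape hcon).exists_three (Z := {q | IsCritical γ q}) fun x y => h.critical_iff
    obtain ⟨a, b, -, hab⟩ := ncard_eq_two.1 hess
    have mp : connectedComponentIn {q | IsCritical γ q} p ∈ essentialCycles γ := ⟨⟨p, hp, rfl⟩, ep⟩
    have mq : connectedComponentIn {q | IsCritical γ q} q ∈ essentialCycles γ := ⟨⟨q, hq, rfl⟩, eq⟩
    have mr : connectedComponentIn {q | IsCritical γ q} r ∈ essentialCycles γ := ⟨⟨r, hr, rfl⟩, er⟩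
    rw [hab, mem_insert_iff, mem_singleton_iff] at mp mq mr
    rcases mp with mp | mp <;> rcases mq with mq | mq <;> rcases mr with mr | mr <;>
      simp_all
  by_cases hp : IsStable γ p
  · exact hst p hp
  · exact .run p (h.exists_run hp) fun q hq => hst q hq.stable

/-- The main diagonal cannot be entered by a walk. -/
theorem diag_of_walk (h : Lifts γ D) {p q : Config} (hw : Walk γ p q) (hq : q.1 = q.2) :
    p.1 = p.2 := by
  obtain ⟨⟨f, hf⟩, hend⟩ := hw
  have hqc : IsCritical γ q := hend.elim (fun h => h.1) fun h => h.elim (fun h => h.1) fun h => h.1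
  have hfc : ∀ t, IsCritical γ (f t) := fun t => by
    rcases lt_or_eq_of_le (unitInterval.le_one' (t := t)) with ht | rfl
    · exact (hf t ht).1
    · simpa using hqc
  have hpc : IsCritical γ p := by simpa using hfc 0
  obtain ⟨ε, hε, -, H⟩ := D.exists_margin
  -- By the margin `ε`, the critical points off the diagonal lie in a closed set disjoint from it,
  -- so no connected set of critical points meets both.
  set Y : Set (ℝ × ℝ) := {z | z.1 + ε ≤ z.2} ∩ {z | z.2 ≤ z.1 + 1 - ε} with hY
  have cY : IsClosed Y :=
    (isClosed_le (by fun_prop) (by fun_prop)).inter (isClosed_le (by fun_prop) (by fun_prop))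
  have sY : ∀ x y, (x, y) ∈ Y → x < y ∧ y < x + 1 := fun x y hz => by
    have h1 : x + ε ≤ y := hz.1
    have h2 : y ≤ x + 1 - ε := hz.2
    constructor <;> linarith
  have pY : ∀ x y, (x + 1, y + 1) ∈ Y ↔ (x, y) ∈ Y := fun x y => by
    simp only [hY, mem_inter_iff, mem_ofPred_eq]
    constructor <;> intro h <;> constructor <;> linarith [h.1, h.2]
  have cover : ∀ r, IsCritical γ r → r ∈ toTorus '' Y ∨ r.1 = r.2 := fun r hr => by
    obtain ⟨x, y, h1, h2, rfl⟩ := exists_toTorus r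
    rcases h1.eq_or_lt with rfl | h1
    · exact .inr rfl
    · exact .inl ⟨(x, y), Attraction.zero_margin H h1 h2 (h.critical_iff.1 hr), rfl⟩
  by_contra hp
  have hpq : connectedComponentIn {q | IsCritical γ q} p = connectedComponentIn _ q :=
    connectedComponentIn_eq ((isPreconnected_range f.continuous).subset_connectedComponentIn
      ⟨0, f.source⟩ (range_subset_iff.2 hfc) ⟨1, f.target⟩)
  exact connectedComponentIn_ne (Z := {q | IsCritical γ q}) (L := {q : Config | q.1 = q.2})
    (isClosed_image_toTorus cY pY sY) (isClosed_eq continuous_fst continuous_snd)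
    (disjoint_image_toTorus_diag sY) cover hpc hqc ((cover p hpc).resolve_right hp) hq hpq

theorem dexter_or_sinister (h : Lifts γ D) {p : Config} (hp : CanCatch γ p) :
    IsDexter γ p ∨ IsSinister γ p := by
  -- Off the diagonal the trivial alternative of `IsDexter` and `IsSinister` is excluded, so there
  -- is a genuine strategy to which the move can be prepended.
  have step : ∀ p q, Move γ p q → q.1 ≠ q.2 → IsDexter γ q ∨ IsSinister γ q →
      IsDexter γ p ∨ IsSinister γ p := by
    rintro p q hm hq (hd | hs)
    · obtain ⟨a, b, h1, h2⟩ := hd.resolve_left hq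
      exact .inl (.inr ⟨a, b, .head hm h1, h2⟩)
    · obtain ⟨a, b, h1, h2⟩ := hs.resolve_left hq
      exact .inr (.inr ⟨a, b, .head hm h1, h2⟩)
  induction hp with
  | caught x => exact .inl (.inl rfl)
  | walk p q hw _ ih =>
    by_cases hq : q.1 = q.2
    · exact .inl (.inl (h.diag_of_walk hw hq))
    · exact step p q (.inl hw) hq ih
  | run p hex _ ih =>
    obtain ⟨q, hr⟩ := hex
    by_cases hq : q.1 = q.2
    · rcases hr with hr | hr
      · exact .inr (.inr ⟨p, q, .refl, hr, hq⟩)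
      · exact .inl (.inr ⟨p, q, .refl, hr, hq⟩)
    · exact step p q (.inr hr) hq (ih q hr)

end Lifts

end Puppy

theorem mainTheorem3 (γ : UnitAddCircle → Puppy.Plane) (hγ : Puppy.IsGenericTrack γ)
    (hess : (Puppy.essentialCycles γ).ncard = 2) :
    (∀ p : Puppy.Config, Puppy.IsDexter γ p ∨ Puppy.IsSinister γ p) ∧
      ∀ p : Puppy.Config, Puppy.CanCatch γ p := by
  obtain ⟨D, hD⟩ := hγ.exists_attraction
  have h : Puppy.Lifts γ D := hD
  exact ⟨fun p => h.dexter_or_sinister (h.canCatch hess p), h.canCatch hess⟩
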